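/- Let $\mathcal J=\mathcal J_0\sqcup\mathcal J_1$ be a finite state space and let $Z=(Z_t)_{t\ge 0}$ be a jump process on $\mathcal J$, with right-continuous piecewise constant paths having finitely many jumps on compact intervals, such that $Z_0=z_0\in\mathcal J_0$ a.s. and $\mathcal J_1$ is absorbing, i.e. $\mathbb P(Z_t\in\mathcal J_1, Z_s\in\mathcal J_0)=0$ for $t\le s$. For $j\ne k$ let $N_{jk}(t)=\#\{s\in(0,t]:Z_{s-}=j,Z_s=k\}$ and assume $\mathbb E[N_{jk}(t)]<\infty$ for all $t\ge 0$. Let $\tau=\inf\{t>0:Z_t\in\mathcal J_1\}$ and, for scaling factors $\rho(\cdot,j,k)\ge 0$ that are predictable with respect to the filtration generated by $Z$ and uniformly bounded on compacts, let $H(t)=\rho(\tau,Z_{\tau-},Z_\tau)^{\mathbf 1\{\tau\le t\}}$. Let $R$ be a strictly positive (finite) random variable independent of $Z$ (entirely random right-censoring), let $\theta\ge0$ lie strictly below the right endpoint of the support of $R$, and let $\varepsilon>0$. Set $$p^{\rho,c}_j(t)=\mathbb E[H(t)\mathbf 1\{Z_t=j\}\mathbf 1\{t<R\}],\qquad p^{\rho,c}_{jk}(t)=\mathbb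 E\Big[\int_0^t H(s)\mathbf 1\{s\le R\}\,N_{jk}(\mathrm ds)\Big],$$ $$\Lambda^{\rho,\varepsilon}_{jk}(t)=\int_0^t\frac{1}{p^{\rho,c}_j(s-)\vee\varepsilon}\,p^{\rho,c}_{jk}(\mathrm ds)\quad(j\ne k),$$ let $\Lambda^{\varepsilon}_{jk}$ denote $\Lambda^{\rho,\varepsilon}_{jk}$ in the unscaled case $\rho\equiv1$, and set $\Lambda^{\rho,\varepsilon}_{jj}=-\sum_{k\ne j}\Lambda^{\varepsilon}_{jk}$ for $j\in\mathcal J_0$ and $\Lambda^{\rho,\varepsilon}_{jj}=-\sum_{k\ne j}\Lambda^{\rho,\varepsilon}_{jk}$ for $j\in\mathcal J_1$. Define $p^{\rho,\varepsilon}_j(t)$ as the $(z_0,j)$ entry of the product integral $\prod_0^t(\mathrm{Id}+\Lambda^{\rho,\varepsilon}(\mathrm ds))$, that is, of the limit of the ordered products $\prod_{i}\big(\mathrm{Id}+\Lambda^{\rho,\varepsilon}(t_i)-\Lambda^{\rho,\varepsilon}(t_{i-1})\big)$ over partitions $0=t_0\le t_1\le\dots\le t_m=t$ as the mesh tends to zero.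 Given i.i.d. replicates $(Z^\ell,R^\ell)_{\ell\ge1}$ of $(Z,R)$, with $H^\ell$ and $N^\ell_{jk}$ formed from $Z^\ell$, let $$\mathbb I^\rho_j(t)=\frac1n\sum_{\ell=1}^nH^\ell(t)\mathbf 1\{Z^\ell_t=j\}\mathbf 1\{t<R^\ell\},\qquad \mathbb N^\rho_{jk}(t)=\frac1n\sum_{\ell=1}^n\int_0^tH^\ell(s)\mathbf 1\{s\le R^\ell\}\,N^\ell_{jk}(\mathrm ds),$$ and let the scaled Nelson--Aalen estimator $\mathbb L^{\rho,\varepsilon}$ and the scaled Aalen--Johansen estimator $\mathbb p^{\rho,\varepsilon}_j$ be defined as $\Lambda^{\rho,\varepsilon}$ (including the diagonal) and $p^{\rho,\varepsilon}_j$, with $p^{\rho,c}_j$, $p^{\rho,c}_{jk}$ (and their unscaled versions) replaced by $\mathbb I^\rho_j$, $\mathbb N^\rho_{jk}$ (and their unscaled versions). Then the product integrals above exist for all $t\in[0,\theta]$ and, for all $j,k\in\mathcal J$, as $n\to\infty$, $$\sup_{0\le t\le\theta}\big|\mathbb L^{\rho,\varepsilon}_{jk}(t)-\Lambda^{\rho,\varepsilon}_{jk}(t)\big|\to0\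 \text{ a.s.},\qquad \sup_{0\le t\le\theta}\big|\mathbb p^{\rho,\varepsilon}_j(t)-p^{\rho,\varepsilon}_j(t)\big|\to0\ \text{ a.s.}$$ -/

import Mathlib

open MeasureTheory ProbabilityTheory Filter Topology
open scoped NNReal ENNReal

noncomputable section

namespace ScaledAJ

/-! ### Paths of jump processes -/

/-- Sample paths of non-explosive jump processes on the (discrete) state space `J`: functions
`[0, ∞) → J` that are right-continuous with left limits.  As `J` is discrete, such a path is
piecewise constant with finitely many jumps on every compact interval. -/
def JumpPath (J : Type*) [TopologicalSpace J] : Type _ :=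
  {z : ℝ≥0 → J // (∀ t, ContinuousWithinAt z (Set.Ici t) t) ∧
    ∀ t, ∃ i, Tendsto z (𝓝[<] t) (𝓝 i)}

namespace JumpPath

variable {J : Type*} [TopologicalSpace J]

instance : CoeFun (JumpPath J) (fun _ => ℝ≥0 → J) := ⟨Subtype.val⟩

/-- The σ-algebra on path space generated by the coordinate maps. -/
instance [MeasurableSpace J] : MeasurableSpace (JumpPath J) :=
  MeasurableSpace.comap (fun (z : JumpPath J) (t : ℝ≥0) => z t) inferInstance

theorem measurable_eval [MeasurableSpace J] (t : ℝ≥0) :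
    Measurable (fun z : JumpPath J => z t) :=
  (measurable_pi_apply t).comp (comap_measurable _)

/-- The filtration generated by the coordinate process on path space.  A process that is
predictable with respect to the filtration generated by `Z` is a predictable process on path
space evaluated along the path of `Z`. -/
def canonicalFiltration (J : Type*) [TopologicalSpace J] [MeasurableSpace J] :
    Filtration ℝ≥0 (inferInstance : MeasurableSpace (JumpPath J)) where
  seq t := ⨆ (s : ℝ≥0) (_ : s ≤ t), MeasurableSpace.comap (fun z : JumpPath J => z s) inferInstance
  mono' _ _ h := iSup₂_le fun s hs => le_iSup₂_of_le s (hs.trans h) le_rfl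
  le' _ := iSup₂_le fun s _ => (measurable_eval s).comap_le

/-- The state `Z_{t-}` just before time `t`. -/
def left (z : JumpPath J) (t : ℝ≥0) : J := Function.leftLim (fun s => z s) t

/-- The set of times `s > 0` at which the path jumps from `j` to `k`. -/
def jumpTimes (z : JumpPath J) (j k : J) : Set ℝ≥0 := {s | 0 < s ∧ z.left s = j ∧ z s = k}

/-- The counting process `N_{jk}(t)`: the number of jumps from `j` to `k` in `(0, t]`. -/
def count (z : JumpPath J) (j k : J) (t : ℝ≥0) : ℕ := (z.jumpTimes j k ∩ Set.Iic t).ncard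

/-- The pathwise integral `∫_0^t h(s) N_{jk}(ds)`, that is, the sum of `h` over the (finitely many)
times in `(0, t]` at which the path jumps from `j` to `k`. -/
def countIntegral (z : JumpPath J) (j k : J) (h : ℝ≥0 → ℝ) (t : ℝ≥0) : ℝ :=
  ∑ᶠ s ∈ z.jumpTimes j k ∩ Set.Iic t, h s

/-- The exercise time `τ = inf {t > 0 : Z_t ∈ J₁}`, equal to `∞` if `J₁` is never hit. -/
def exerciseTime (J₁ : Set J) (z : JumpPath J) : ℝ≥0∞ :=
  ⨅ (t : ℝ≥0) (_ : 0 < t ∧ z t ∈ J₁), (t : ℝ≥0∞)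

open scoped Classical in
/-- The scaling process `H(t) = ρ(τ, Z_{τ-}, Z_τ) ^ 1{τ ≤ t}`.  The last argument of `ρ` is the
whole path, so that the scaling factors may be random. -/
def scaling (ρ : ℝ≥0 → J → J → JumpPath J → ℝ) (J₁ : Set J) (z : JumpPath J) (t : ℝ≥0) : ℝ :=
  if z.exerciseTime J₁ ≤ (t : ℝ≥0∞) then
    ρ (z.exerciseTime J₁).toNNReal (z.left (z.exerciseTime J₁).toNNReal)
      (z (z.exerciseTime J₁).toNNReal) z
  else 1

open scoped Classical in
/-- `H(t) 1{Z_t = j} 1{t < R}` for the path `z` of `Z` and the value `r` of `R`. -/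
def exposure (ρ : ℝ≥0 → J → J → JumpPath J → ℝ) (J₁ : Set J) (j : J) (t : ℝ≥0)
    (z : JumpPath J) (r : ℝ≥0) : ℝ :=
  if z t = j ∧ t < r then z.scaling ρ J₁ t else 0

open scoped Classical in
/-- `∫_0^t H(s) 1{s ≤ R} N_{jk}(ds)` for the path `z` of `Z` and the value `r` of `R`. -/
def transitions (ρ : ℝ≥0 → J → J → JumpPath J → ℝ) (J₁ : Set J) (j k : J) (t : ℝ≥0)
    (z : JumpPath J) (r : ℝ≥0) : ℝ :=
  z.countIntegral j k (fun s => z.scaling ρ J₁ s * (if s ≤ r then 1 else 0)) t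

end JumpPath

/-! ### Lebesgue–Stieltjes integrals and product integrals -/

open scoped Classical in
/-- The Lebesgue–Stieltjes measure on `[0, ∞)` of a non-decreasing right-continuous function `F`:
it gives mass `F b - F a` to `(a, b]`, and no mass to `{0}`. -/
def lsMeasure (F : ℝ≥0 → ℝ) : Measure ℝ≥0 :=
  if hF : Monotone F then hF.stieltjesFunction.measure else 0

/-- The perturbed cumulative hazard `∫_0^t 1 / (I(s-) ∨ ε) N(ds)`. -/
def perturbedHazard (ε : ℝ) (I N : ℝ≥0 → ℝ) (t : ℝ≥0) : ℝ :=
  ∫ s in Set.Ioc 0 t, 1 / max (Function.leftLim I s) ε ∂(lsMeasure N)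

/-- The ordered product `∏_{i < m} (Id + A(u (i+1)) - A(u i))`, factors from left to right. -/
def partitionProd {J : Type*} [Fintype J] [DecidableEq J] (A : ℝ≥0 → Matrix J J ℝ) (u : ℕ → ℝ≥0) :
    ℕ → Matrix J J ℝ
  | 0 => 1
  | m + 1 => partitionProd A u m * (1 + (A (u (m + 1)) - A (u m)))

/-- `M` is the product integral of `Id + A(ds)` over `(0, t]`: the products over the partitions
`0 = u 0 ≤ u 1 ≤ ⋯ ≤ u m = t` converge to `M` as the mesh tends to zero. -/
def IsProdInt {J : Type*} [Fintype J] [DecidableEq J] (A : ℝ≥0 → Matrix J J ℝ) (t : ℝ≥0)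
    (M : Matrix J J ℝ) : Prop :=
  ∀ η : ℝ, 0 < η → ∃ δ : ℝ≥0, 0 < δ ∧ ∀ (m : ℕ) (u : ℕ → ℝ≥0), Monotone u → u 0 = 0 → u m = t →
    (∀ i < m, u (i + 1) < u i + δ) → ∀ j k, |partitionProd A u m j k - M j k| < η

open scoped Classical in
/-- The product integral of `Id + A(ds)` over `(0, t]` (the zero matrix if it does not exist). -/
def prodInt {J : Type*} [Fintype J] [DecidableEq J] (A : ℝ≥0 → Matrix J J ℝ) (t : ℝ≥0) :
    Matrix J J ℝ :=
  if h : ∃ M, IsProdInt A t M then h.choose else 0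

/-! ### Targets and estimators -/

open scoped Classical in
/-- The matrix with off-diagonal entries `L j k`, and whose diagonal is chosen such that row `j`
of the off-diagonal entries of `L` (if `j ∈ J₁`) or of `L'` (if `j ∉ J₁`) together with the
diagonal entry sums to zero. -/
def hazardMatrix {J : Type*} [Fintype J] (J₁ : Set J) (L L' : J → J → ℝ≥0 → ℝ) (t : ℝ≥0) :
    Matrix J J ℝ :=
  Matrix.of fun j k =>
    if j ≠ k then L j k t
    else if j ∈ J₁ then - ∑ l ∈ Finset.univ.erase j, L j l t
    else - ∑ l ∈ Finset.univ.erase j, L' j l t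

section

variable {J : Type*} [TopologicalSpace J] {Ω : Type*}

/-- The unscaled case: all scaling factors constantly equal to one. -/
def unscaled : ℝ≥0 → J → J → JumpPath J → ℝ := fun _ _ _ _ => 1

/-- `Λ_{jk}^{ρ,ε}`, off the diagonal: the perturbed target hazard, formed from
`p_j^{ρ,c}(t) = E[H(t) 1{Z_t = j} 1{t < R}]` and
`p_{jk}^{ρ,c}(t) = E[∫_0^t H(s) 1{s ≤ R} N_{jk}(ds)]`. -/
def targetHazardEntry [MeasurableSpace Ω] (P : Measure Ω) (Z : Ω → JumpPath J) (R : Ω → ℝ≥0)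
    (J₁ : Set J) (ε : ℝ) (ρ : ℝ≥0 → J → J → JumpPath J → ℝ) (j k : J) : ℝ≥0 → ℝ :=
  perturbedHazard ε (fun t => ∫ ω, (Z ω).exposure ρ J₁ j t (R ω) ∂P)
    (fun t => ∫ ω, (Z ω).transitions ρ J₁ j k t (R ω) ∂P)

/-- The target hazard matrix `Λ^{ρ,ε}`. -/
def targetHazard [Fintype J] [MeasurableSpace Ω] (P : Measure Ω) (Z : Ω → JumpPath J)
    (R : Ω → ℝ≥0) (J₁ : Set J) (ε : ℝ) (ρ : ℝ≥0 → J → J → JumpPath J → ℝ) :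
    ℝ≥0 → Matrix J J ℝ :=
  hazardMatrix J₁ (targetHazardEntry P Z R J₁ ε ρ) (targetHazardEntry P Z R J₁ ε unscaled)

/-- The scaled Nelson–Aalen estimator off the diagonal, formed at the outcome `ω` from the first
`n` replicates. -/
def nelsonAalenEntry (Zs : ℕ → Ω → JumpPath J) (Rs : ℕ → Ω → ℝ≥0)
    (J₁ : Set J) (ε : ℝ) (ρ : ℝ≥0 → J → J → JumpPath J → ℝ) (n : ℕ) (ω : Ω) (j k : J) : ℝ≥0 → ℝ :=
  perturbedHazard ε
    (fun t => 1 / (n : ℝ) * ∑ l ∈ Finset.range n, (Zs l ω).exposure ρ J₁ j t (Rs l ω))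
    (fun t => 1 / (n : ℝ) * ∑ l ∈ Finset.range n, (Zs l ω).transitions ρ J₁ j k t (Rs l ω))

/-- The scaled Nelson–Aalen estimator (a matrix). -/
def nelsonAalen [Fintype J] (Zs : ℕ → Ω → JumpPath J) (Rs : ℕ → Ω → ℝ≥0)
    (J₁ : Set J) (ε : ℝ) (ρ : ℝ≥0 → J → J → JumpPath J → ℝ) (n : ℕ) (ω : Ω) :
    ℝ≥0 → Matrix J J ℝ :=
  hazardMatrix J₁ (nelsonAalenEntry Zs Rs J₁ ε ρ n ω) (nelsonAalenEntry Zs Rs J₁ ε unscaled n ω)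

end

/-- The right endpoint of the support of a measure on `[0, ∞)`. -/
def rightEndpoint (μ : Measure ℝ≥0) : ℝ≥0∞ := ⨆ x ∈ μ.support, (x : ℝ≥0∞)

end ScaledAJ

end

/-!
The proof rests on one notion.  A *control* is a monotone right-continuous function `v`, and `f` is
controlled by `v` up to time `T` if `|f t - f s| ≤ v t - v s` for `s ≤ t ≤ T`.  Along a path, the
scaling process changes only at jumps of the path, so exposures and transitions change only when
the path jumps or the observation is censored.  Up to time `T` they are therefore controlled by a
multiple `V` of the number of these events (`eventBound`), which is integrable.  Averages and
expectations inherit the control, which supplies the regularity of all functions below.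

* Strong law (`tendstoUniformlyOn_avg`).  By compactness (`IsControl.exists_finset`), finitely many
  points cut `[0, T]` into intervals on each of which the mean of `V` varies by at most `η`.  The
  ordinary strong law at these points, applied to the process and to `V` and its left limits, gives
  uniform convergence: the Glivenko–Cantelli argument.
* Nelson–Aalen estimator (`tendstoUniformlyOn_perturbedHazard`).  The integrand `1 / (I(s-) ∨ ε)`
  is a Lipschitz function of `I(s-)`.  Hence replacing the empirical exposure by its limit is
  harmless, and the limiting integrand is uniformly close to a step function, for which uniform
  convergence of the integrators is enough.
* Product integrals (`norm_prod_sub_prod_le`).  Summation by parts and a Gronwall estimate show that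
  the products along one partition depend on the integrator in a Lipschitz way with respect to the
  *sup norm*, with a constant which depends only on the total mass of the controls.  The partition
  products of a step function are constant once the mesh is small, and a controlled function is a
  uniform limit of controlled step functions, so that its partition products converge
  (`exists_isProdInt`).  The Lipschitz bound passes to the product integrals
  (`abs_prodInt_sub_le`), and the Aalen–Johansen estimator inherits the convergence of the
  Nelson–Aalen estimator (`tendstoUniformlyOn_aalenJohansen`).

Measurability of the transitions as functions of the path follows from an exact discretization
(`countIntegral_eventually_eq`): on a grid so fine that each cell contains at most one jump, the
jumps from `j` to `k` are the cells in which the path moves from `j` to `k`.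
-/

namespace ScaledAJ

/-! ### Controls and partitions adapted to them -/

/-- A compactness argument: if a relation between times holds near each `x ≤ T` for pairs of times
on the same side of `x` (where `x` itself counts as lying to the right), then it holds for all
`s < t ≤ T` such that `(s, t]` avoids a suitable finite set. -/
theorem exists_finset_of_local (Q : ℝ≥0 → ℝ≥0 → Prop) (T : ℝ≥0)
    (h : ∀ x ≤ T, ∀ᶠ U in (𝓝 x).smallSets, ∀ s ∈ U, ∀ t ∈ U, s < t → (t < x ∨ x ≤ s) → Q s t) :
    ∃ X : Finset ℝ≥0, ∀ s t, s < t → t ≤ T → (∀ x ∈ X, s < x → t < x) → Q s t := by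
  have h' : ∀ x ≤ T, ∃ r : ℝ≥0, 0 < r ∧ ∀ s ∈ Metric.ball x r, ∀ t ∈ Metric.ball x r,
      s < t → (t < x ∨ x ≤ s) → Q s t := by
    intro x hx
    obtain ⟨U, hU, hQ⟩ := eventually_smallSets.1 (h x hx)
    obtain ⟨r, hr, hrU⟩ := Metric.mem_nhds_iff.1 hU
    exact ⟨⟨r, hr.le⟩, hr, hQ _ hrU⟩
  choose! r hr hQ using h'
  obtain ⟨Y, hY, hcov⟩ := (isCompact_Icc (a := (0 : ℝ≥0)) (b := T)).elim_nhds_subcover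
    (fun x => Metric.ball x (r x))
    (fun x hx => Metric.ball_mem_nhds _ (by exact_mod_cast hr x hx.2))
  -- the right ends of the balls are included, so that `(s, t]` cannot leave the ball around `x`
  refine ⟨Y ∪ Y.image (fun x => x + r x), fun s t hst htT hX => ?_⟩
  obtain ⟨x, hxY, hsx⟩ := Set.mem_iUnion₂.1 (hcov ⟨zero_le, hst.le.trans htT⟩ : s ∈ _)
  have h1 := hX x (by simp [hxY])
  have h2 := hX (x + r x) (Finset.mem_union_right _ (Finset.mem_image_of_mem _ hxY))
  have h3 := hsx
  rw [Metric.mem_ball, NNReal.dist_eq, abs_lt] at h3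
  have h4 : s < x + r x := by
    rw [← NNReal.coe_lt_coe]; push_cast; linarith
  have h5 := h2 h4
  have h6 : t ∈ Metric.ball x (r x) := by
    rw [Metric.mem_ball, NNReal.dist_eq, abs_lt]
    rw [← NNReal.coe_lt_coe] at h5 hst
    push_cast at h5
    constructor <;> linarith
  refine hQ x (hY x hxY).2 s hsx t h6 hst ?_
  rcases lt_or_ge s x with h | h
  · exact Or.inl (h1 h)
  · exact Or.inr h

/-- The functions used to bound increments: monotone and right-continuous. -/
structure IsControl (v : ℝ≥0 → ℝ) : Prop where
  mono : Monotone v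
  rightCont : ∀ t, ContinuousWithinAt v (Set.Ici t) t

/-- Up to time `T`, the increments of `f` are bounded in norm by those of `v`. -/
def ControlledOn (T : ℝ≥0) (v : ℝ≥0 → ℝ) {E : Type*} [SeminormedAddCommGroup E] (f : ℝ≥0 → E) :
    Prop :=
  ∀ s t, s ≤ t → t ≤ T → ‖f t - f s‖ ≤ v t - v s

/-- A control varies by less than `η` between times that no point of a suitable finite set
separates. -/
theorem IsControl.exists_finset {v : ℝ≥0 → ℝ} (hv : IsControl v) (T : ℝ≥0) {η : ℝ} (hη : 0 < η) :
    ∃ X : Finset ℝ≥0, ∀ s t, s ≤ t → t ≤ T → (∀ x ∈ X, s < x → t < x) → v t - v s < η := by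
  obtain ⟨X, hX⟩ := exists_finset_of_local (fun s t => v t - v s < η) T (by
    intro x _
    have h1 := (hv.mono.tendsto_leftLim x).eventually (Metric.ball_mem_nhds _ (half_pos hη))
    have h2 := (hv.rightCont x).eventually (Metric.ball_mem_nhds _ (half_pos hη))
    rw [eventually_nhdsWithin_iff] at h1 h2
    refine eventually_smallSets.2 ⟨_, h1.and h2, fun U hU s hs t ht hst hx => ?_⟩
    have hs' := hU hs
    have ht' := hU ht
    rcases hx with hx | hx
    · have a := hs'.1 (hst.trans hx)
      have b := ht'.1 hx
      rw [Real.dist_eq, abs_lt] at a b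
      linarith
    · have a := hs'.2 hx
      have b := ht'.2 (hx.trans hst.le)
      rw [Real.dist_eq, abs_lt] at a b
      linarith)
  refine ⟨X, fun s t hst htT h => ?_⟩
  rcases hst.eq_or_lt with rfl | hst
  · simpa using hη
  · exact hX s t hst htT h

theorem IsControl.const_mul {v : ℝ≥0 → ℝ} (hv : IsControl v) {c : ℝ} (hc : 0 ≤ c) :
    IsControl fun t => c * v t :=
  ⟨fun _ _ hst => mul_le_mul_of_nonneg_left (hv.mono hst) hc,
    fun t => continuousWithinAt_const.mul (hv.rightCont t)⟩

/-- The distinct points of a finite set keep a positive distance from each other. -/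
theorem exists_pos_gap (X : Finset ℝ≥0) :
    ∃ δ : ℝ≥0, 0 < δ ∧ ∀ x ∈ X, ∀ y ∈ X, x < y → x + δ ≤ y := by
  classical
  induction X using Finset.induction_on_max with
  | empty => exact ⟨1, one_pos, by simp⟩
  | insert a s ha ih =>
    obtain ⟨δ, hδ, h⟩ := ih
    have : ∃ γ : ℝ≥0, 0 < γ ∧ ∀ x ∈ s, x + γ ≤ a := by
      rcases s.eq_empty_or_nonempty with rfl | hs
      · exact ⟨1, one_pos, by simp⟩
      · refine ⟨a - s.max' hs, tsub_pos_of_lt (ha _ (s.max'_mem hs)), fun x hx => ?_⟩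
        calc x + (a - s.max' hs) ≤ s.max' hs + (a - s.max' hs) := by gcongr; exact s.le_max' x hx
          _ = a := add_tsub_cancel_of_le (ha _ (s.max'_mem hs)).le
    obtain ⟨γ, hγ, h'⟩ := this
    refine ⟨min δ γ, lt_min hδ hγ, fun x hx y hy hxy => ?_⟩
    rw [Finset.mem_insert] at hx hy
    rcases hx with rfl | hx
    · rcases hy with rfl | hy
      · exact absurd hxy (lt_irrefl _)
      · exact absurd hxy (ha y hy).not_gt
    · rcases hy with rfl | hy
      · exact (add_le_add le_rfl (min_le_right _ _)).trans (h' x hx)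
      · exact (add_le_add le_rfl (min_le_left _ _)).trans (h x hx y hy hxy)

/-- The level function `N` counts the points of a finite set passed so far: a control varies by less
than `η` on each level, and time steps shorter than `δ` move up by at most one level. -/
theorem IsControl.exists_levels {v : ℝ≥0 → ℝ} (hv : IsControl v) (T : ℝ≥0) {η : ℝ} (hη : 0 < η) :
    ∃ (N : ℝ≥0 → ℕ) (δ : ℝ≥0), 0 < δ ∧ N 0 = 0 ∧ Monotone N ∧
      (∀ s t, t < s + δ → N t ≤ N s + 1) ∧
      ∀ s t, s ≤ t → t ≤ T → N s = N t → v t - v s < η := by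
  classical
  obtain ⟨X, hX⟩ := hv.exists_finset T hη
  obtain ⟨δ, hδ, hgap⟩ := exists_pos_gap X
  have hsub : ∀ {s t : ℝ≥0}, s ≤ t →
      X.filter (fun x => 0 < x ∧ x ≤ s) ⊆ X.filter (fun x => 0 < x ∧ x ≤ t) := fun hst x => by
    simp only [Finset.mem_filter]
    exact fun ⟨h1, h2, h3⟩ => ⟨h1, h2, h3.trans hst⟩
  have hmono : Monotone (fun t => (X.filter (fun x => 0 < x ∧ x ≤ t)).card) :=
    fun s t hst => Finset.card_le_card (hsub hst)
  refine ⟨fun t => (X.filter (fun x => 0 < x ∧ x ≤ t)).card, δ, hδ, ?_, hmono, ?_, ?_⟩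
  · rw [Finset.card_eq_zero, Finset.filter_eq_empty_iff]
    rintro x - ⟨h1, h2⟩
    exact h1.not_ge h2
  · intro s t hst
    rcases le_or_gt t s with h | h
    · exact (hmono h).trans (Nat.le_succ _)
    have h1 : (X.filter (fun x => s < x ∧ x ≤ t)).card ≤ 1 := by
      rw [Finset.card_le_one]
      intro a ha b hb
      simp only [Finset.mem_filter] at ha hb
      by_contra hab
      rcases lt_or_gt_of_ne hab with hab | hab
      · exact absurd (hgap a ha.1 b hb.1 hab)
          (not_le.2 (hb.2.2.trans_lt (hst.trans (by gcongr; exact ha.2.1))))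
      · exact absurd (hgap b hb.1 a ha.1 hab)
          (not_le.2 (ha.2.2.trans_lt (hst.trans (by gcongr; exact hb.2.1))))
    refine le_trans (Finset.card_le_card (t := X.filter (fun x => 0 < x ∧ x ≤ s) ∪
      X.filter (fun x => s < x ∧ x ≤ t)) ?_) ((Finset.card_union_le _ _).trans (by gcongr))
    intro x
    simp only [Finset.mem_filter, Finset.mem_union]
    rintro ⟨h1, h2, h3⟩
    rcases le_or_gt x s with h | h
    · exact Or.inl ⟨h1, h2, h⟩
    · exact Or.inr ⟨h1, h, h3⟩
  · intro s t hst htT hN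
    refine hX s t hst htT fun x hx hsx => ?_
    by_contra! hxt
    have heq := Finset.eq_of_subset_of_card_le (hsub hst) hN.ge
    have : x ∈ X.filter (fun x => 0 < x ∧ x ≤ s) := by
      rw [heq, Finset.mem_filter]; exact ⟨hx, (zero_le).trans_lt hsx, hxt⟩
    exact (Finset.mem_filter.1 this).2.2.not_gt hsx

/-! ### Left limits and approximation from a grid -/

theorem ControlledOn.exists_tendsto_left {T : ℝ≥0} {v f : ℝ≥0 → ℝ} (hv : Monotone v)
    (hf : ControlledOn T v f) {s : ℝ≥0} (hs : s ≤ T) : ∃ L, Tendsto f (𝓝[<] s) (𝓝 L) := by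
  rcases eq_or_ne s 0 with rfl | hs0
  · exact ⟨0, by simp⟩
  have : (𝓝[<] s).NeBot := nhdsLT_neBot_of_exists_lt ⟨0, pos_iff_ne_zero.2 hs0⟩
  refine cauchy_map_iff_exists_tendsto.1 (Metric.cauchy_iff.2 ⟨inferInstance, fun η hη => ?_⟩)
  have h1 := (hv.tendsto_leftLim s).eventually (Metric.ball_mem_nhds _ (half_pos hη))
  refine ⟨f '' {x | dist (v x) (Function.leftLim v s) < η / 2 ∧ x < s},
    image_mem_map (h1.and self_mem_nhdsWithin), ?_⟩
  have key : ∀ x y, x ≤ y → y < s → dist (v x) (Function.leftLim v s) < η / 2 →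
      dist (v y) (Function.leftLim v s) < η / 2 → |f y - f x| < η := by
    intro x y hxy hy h1 h2
    rw [Real.dist_eq, abs_lt] at h1 h2
    have := hf x y hxy (hy.le.trans hs)
    rw [Real.norm_eq_abs] at this
    linarith
  rintro _ ⟨x, ⟨hx, hxs⟩, rfl⟩ _ ⟨y, ⟨hy, hys⟩, rfl⟩
  rw [Real.dist_eq]
  rcases le_total x y with h | h
  · rw [abs_sub_comm]; exact key x y h hys hx hy
  · exact key y x h hxs hy hx

theorem tendsto_leftLim_of_exists {E : Type*} [TopologicalSpace E] {f : ℝ≥0 → E} {s : ℝ≥0}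
    (h : ∃ L, Tendsto f (𝓝[<] s) (𝓝 L)) : Tendsto f (𝓝[<] s) (𝓝 (Function.leftLim f s)) :=
  tendsto_leftLim_of_tendsto h

/-- The last point of the grid of step `1 / (n + 1)` strictly before `s` (and `0` if `s = 0`). -/
noncomputable def gridLeft (n : ℕ) (s : ℝ≥0) : ℝ≥0 :=
  ((⌈((n : ℝ≥0) + 1) * s⌉₊ - 1 : ℕ) : ℝ≥0) / (n + 1)

theorem gridLeft_lt (n : ℕ) {s : ℝ≥0} (hs : 0 < s) : gridLeft n s < s := by
  unfold gridLeft
  have hp : 0 < ((n : ℝ≥0) + 1) * s := by positivity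
  rw [div_lt_iff₀ (by positivity), mul_comm s]
  exact Nat.lt_ceil.1 (Nat.sub_lt (Nat.ceil_pos.2 hp) one_pos)

theorem tendsto_gridLeft {s : ℝ≥0} (hs : 0 < s) :
    Tendsto (fun n => gridLeft n s) atTop (𝓝[<] s) := by
  refine tendsto_nhdsWithin_iff.2 ⟨?_, Eventually.of_forall fun n => gridLeft_lt n hs⟩
  rw [← NNReal.tendsto_coe]
  have h : Tendsto (fun n : ℕ => (s : ℝ) - 1 / ((n : ℝ) + 1)) atTop (𝓝 (s - 0)) :=
    tendsto_const_nhds.sub tendsto_one_div_add_atTop_nhds_zero_nat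
  rw [sub_zero] at h
  refine tendsto_of_tendsto_of_tendsto_of_le_of_le h tendsto_const_nhds (fun n => ?_)
    (fun n => (NNReal.coe_lt_coe.2 (gridLeft_lt n hs)).le)
  have h1 : ((n : ℝ) + 1) * s ≤ (⌈((n : ℝ≥0) + 1) * s⌉₊ : ℝ) := by
    exact_mod_cast Nat.le_ceil (((n : ℝ≥0) + 1) * s)
  have h2 : (⌈((n : ℝ≥0) + 1) * s⌉₊ : ℝ) ≤ ((⌈((n : ℝ≥0) + 1) * s⌉₊ - 1 : ℕ) : ℝ) + 1 := by
    norm_cast; omega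
  simp only [gridLeft]
  rw [NNReal.coe_div, NNReal.coe_natCast, NNReal.coe_add, NNReal.coe_natCast, NNReal.coe_one]
  rw [le_div_iff₀ (by positivity), sub_mul, one_div, inv_mul_cancel₀ (by positivity)]
  linarith

/-- The left limit at `s` is a limit of functions of `⌈(n + 1) s⌉`. -/
theorem measurable_leftLim {f : ℝ≥0 → ℝ} (hf : ∀ s, ∃ L, Tendsto f (𝓝[<] s) (𝓝 L)) :
    Measurable (Function.leftLim f) := by
  refine measurable_of_tendsto_metrizable (f := fun n s => f (gridLeft n s)) (fun n => ?_)
    (tendsto_pi_nhds.2 fun s => ?_)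
  · exact (measurable_from_nat (f := fun k : ℕ => f (((k - 1 : ℕ) : ℝ≥0) / (n + 1)))).comp
      (Nat.measurable_ceil.comp (measurable_const.mul measurable_id))
  · rcases eq_or_ne s 0 with rfl | hs
    · rw [leftLim_eq_of_isBot (fun _ => zero_le)]
      simp [gridLeft]
    · exact (tendsto_leftLim_of_exists (hf s)).comp (tendsto_gridLeft (pos_iff_ne_zero.2 hs))

/-- The first point of the grid of step `1 / (n + 1)` strictly after `s`. -/
noncomputable def gridRight (n : ℕ) (s : ℝ≥0) : ℝ≥0 :=
  ((⌊((n : ℝ≥0) + 1) * s⌋₊ + 1 : ℕ) : ℝ≥0) / (n + 1)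

theorem lt_gridRight (n : ℕ) (s : ℝ≥0) : s < gridRight n s := by
  unfold gridRight
  rw [lt_div_iff₀ (by positivity), mul_comm s]
  exact_mod_cast Nat.lt_floor_add_one (((n : ℝ≥0) + 1) * s)

theorem tendsto_gridRight (s : ℝ≥0) : Tendsto (fun n => gridRight n s) atTop (𝓝[≥] s) := by
  refine tendsto_nhdsWithin_iff.2 ⟨?_, Eventually.of_forall fun n => (lt_gridRight n s).le⟩
  rw [← NNReal.tendsto_coe]
  have h : Tendsto (fun n : ℕ => (s : ℝ) + 1 / ((n : ℝ) + 1)) atTop (𝓝 (s + 0)) :=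
    tendsto_const_nhds.add tendsto_one_div_add_atTop_nhds_zero_nat
  rw [add_zero] at h
  refine tendsto_of_tendsto_of_tendsto_of_le_of_le tendsto_const_nhds h
    (fun n => (NNReal.coe_lt_coe.2 (lt_gridRight n s)).le) (fun n => ?_)
  have h1 : (⌊((n : ℝ≥0) + 1) * s⌋₊ : ℝ) ≤ ((n : ℝ) + 1) * s := by
    exact_mod_cast Nat.floor_le (zero_le (a := ((n : ℝ≥0) + 1) * s))
  have h2 : ((s : ℝ) + 1 / ((n : ℝ) + 1)) * ((n : ℝ) + 1) = ((n : ℝ) + 1) * s + 1 := by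
    field_simp
  simp only [gridRight]
  rw [NNReal.coe_div, NNReal.coe_natCast, NNReal.coe_add, NNReal.coe_natCast, NNReal.coe_one,
    div_le_iff₀ (by positivity), h2, Nat.cast_add, Nat.cast_one]
  linarith

/-- On each compact interval, `f` is controlled by some control. -/
def LocallyControlled (f : ℝ≥0 → ℝ) : Prop :=
  ∀ T, ∃ v, IsControl v ∧ ControlledOn T v f

theorem LocallyControlled.exists_tendsto_left {f : ℝ≥0 → ℝ} (hf : LocallyControlled f) (s : ℝ≥0) :
    ∃ L, Tendsto f (𝓝[<] s) (𝓝 L) :=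
  let ⟨_, hv, hfv⟩ := hf s
  hfv.exists_tendsto_left hv.mono le_rfl

theorem LocallyControlled.isControl {f : ℝ≥0 → ℝ} (hf : LocallyControlled f) (hm : Monotone f) :
    IsControl f := by
  refine ⟨hm, fun t => ?_⟩
  obtain ⟨v, hv, hfv⟩ := hf (t + 1)
  have h1 : Tendsto (fun s => v s - v t) (𝓝[≥] t) (𝓝 0) := by
    simpa using (hv.rightCont t).tendsto.sub_const (v t)
  refine tendsto_iff_dist_tendsto_zero.2 (squeeze_zero' (Eventually.of_forall fun _ => dist_nonneg)
    ?_ h1)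
  filter_upwards [self_mem_nhdsWithin, nhdsWithin_le_nhds (Iio_mem_nhds (lt_add_one t))]
    with s hs hs'
  rw [dist_eq_norm]
  exact hfv t s hs (le_of_lt hs')

/-! ### Partition products and product integrals -/

theorem norm_prod_le {R : Type*} [NormedRing R] [NormOneClass R] {a X : ℕ → R} {w : ℕ → ℝ}
    (hX0 : X 0 = 1) {m : ℕ} (hX : ∀ i < m, X (i + 1) = X i * (1 + (a (i + 1) - a i)))
    (ha : ∀ i < m, ‖a (i + 1) - a i‖ ≤ w (i + 1) - w i) :
    ∀ i ≤ m, ‖X i‖ ≤ Real.exp (w i - w 0) := by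
  intro i
  induction i with
  | zero => intro _; simp [hX0]
  | succ i ih =>
    intro hi
    rw [hX i hi]
    have h1 : ‖1 + (a (i + 1) - a i)‖ ≤ Real.exp (w (i + 1) - w i) := by
      refine (norm_add_le _ _).trans ?_
      rw [norm_one]
      have := Real.add_one_le_exp (w (i + 1) - w i)
      linarith [ha i hi]
    calc _ ≤ ‖X i‖ * ‖1 + (a (i + 1) - a i)‖ := norm_mul_le _ _
      _ ≤ Real.exp (w i - w 0) * Real.exp (w (i + 1) - w i) := by
        gcongr; exact ih (by omega)
      _ = _ := by rw [← Real.exp_add]; congr 1; ring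

/-- The distance between the products of `1 + Δa` and of `1 + Δb` is bounded by the *uniform*
distance `d` of `a` and `b`, up to a constant that depends only on a common bound `w` of the
variations. -/
theorem norm_prod_sub_prod_le {R : Type*} [NormedRing R] [NormOneClass R] {a b X Y : ℕ → R}
    {w : ℕ → ℝ} {d : ℝ} (hX0 : X 0 = 1) (hY0 : Y 0 = 1) {m : ℕ}
    (hX : ∀ i < m, X (i + 1) = X i * (1 + (a (i + 1) - a i)))
    (hY : ∀ i < m, Y (i + 1) = Y i * (1 + (b (i + 1) - b i)))
    (ha : ∀ i < m, ‖a (i + 1) - a i‖ ≤ w (i + 1) - w i)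
    (hb : ∀ i < m, ‖b (i + 1) - b i‖ ≤ w (i + 1) - w i)
    (hd : ∀ i ≤ m, ‖a i - b i‖ ≤ d) :
    ‖X m - Y m‖ ≤ Real.exp (w m - w 0) * (2 + 2 * (w m - w 0)) * d := by
  have hXn := norm_prod_le hX0 hX ha
  have hd0 : 0 ≤ d := (norm_nonneg _).trans (hd 0 (Nat.zero_le _))
  -- Summation by parts: after subtraction of the boundary term `X i * (a i - b i)`, the difference
  -- satisfies a recursion in which only the increments of `a` and `b` are multiplied by `a - b`.
  have key : ∀ i ≤ m, 0 ≤ w i - w 0 ∧ ‖X i - Y i - X i * (a i - b i)‖ ≤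
      Real.exp (w i - w 0) * (d * (1 + 2 * (w i - w 0))) := by
    intro i
    induction i with
    | zero => intro _; simpa [hX0, hY0, norm_sub_rev] using hd 0 (Nat.zero_le _)
    | succ i ih =>
      intro hi
      obtain ⟨hw, ih⟩ := ih (by omega)
      have hδ : 0 ≤ w (i + 1) - w i := (norm_nonneg _).trans (ha i hi)
      refine ⟨by linarith, ?_⟩
      set δ := w (i + 1) - w i with hδdef
      set W := w i - w 0 with hWdef
      have hWδ : w (i + 1) - w 0 = W + δ := by rw [hδdef, hWdef]; ring
      rw [hWδ]
      have hid : X (i + 1) - Y (i + 1) - X (i + 1) * (a (i + 1) - b (i + 1)) =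
          (X i - Y i - X i * (a i - b i)) * (1 + (b (i + 1) - b i)) +
          X i * ((a i - b i) * (b (i + 1) - b i) -
            (a (i + 1) - a i) * (a (i + 1) - b (i + 1))) := by
        rw [hX i hi, hY i hi]; noncomm_ring
      have h1 : ‖1 + (b (i + 1) - b i)‖ ≤ 1 + δ :=
        (norm_add_le _ _).trans (by rw [norm_one]; linarith [hb i hi])
      have h2 : ‖(a i - b i) * (b (i + 1) - b i) -
            (a (i + 1) - a i) * (a (i + 1) - b (i + 1))‖ ≤ d * δ + δ * d := by
        refine (norm_sub_le _ _).trans (add_le_add ?_ ?_)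
        · refine (norm_mul_le _ _).trans ?_
          gcongr
          exacts [hd i (by omega), hb i hi]
        · refine (norm_mul_le _ _).trans ?_
          gcongr
          exacts [ha i hi, hd _ hi]
      rw [hid]
      have hE := Real.exp_pos W
      have hEδ : 1 + δ ≤ Real.exp δ := by linarith [Real.add_one_le_exp δ]
      calc _ ≤ ‖X i - Y i - X i * (a i - b i)‖ * ‖1 + (b (i + 1) - b i)‖ +
            ‖X i‖ * ‖(a i - b i) * (b (i + 1) - b i) -
            (a (i + 1) - a i) * (a (i + 1) - b (i + 1))‖ :=
            (norm_add_le _ _).trans (add_le_add (norm_mul_le _ _) (norm_mul_le _ _))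
        _ ≤ (Real.exp W * (d * (1 + 2 * W))) * (1 + δ) + Real.exp W * (d * δ + δ * d) := by
            gcongr
            exact hXn i (by omega)
        _ ≤ (Real.exp W * (d * (1 + 2 * W))) * (1 + δ) +
            Real.exp W * (d * δ + δ * d) * (1 + δ) := by
            have : 0 ≤ Real.exp W * (d * δ + δ * d) * δ := by positivity
            linarith
        _ = Real.exp W * (1 + δ) * (d * (1 + 2 * (W + δ))) := by ring
        _ ≤ Real.exp W * Real.exp δ * (d * (1 + 2 * (W + δ))) := by gcongr
        _ = _ := by rw [← Real.exp_add]
  obtain ⟨hw, hF⟩ := key m le_rfl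
  have hE := Real.exp_pos (w m - w 0)
  calc ‖X m - Y m‖ = ‖(X m - Y m - X m * (a m - b m)) + X m * (a m - b m)‖ := by
        rw [sub_add_cancel]
    _ ≤ Real.exp (w m - w 0) * (d * (1 + 2 * (w m - w 0))) + Real.exp (w m - w 0) * d := by
        refine (norm_add_le _ _).trans (add_le_add hF ((norm_mul_le _ _).trans ?_))
        gcongr
        exacts [hXn m le_rfl, hd m le_rfl]
    _ = _ := by ring

section Product

open scoped Matrix.Norms.Operator

variable {J : Type*} [Fintype J] [DecidableEq J]

theorem abs_entry_le_norm (M : Matrix J J ℝ) (j k : J) : |M j k| ≤ ‖M‖ := by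
  rw [Matrix.linfty_opNorm_def]
  have h1 : ‖M j k‖₊ ≤ ∑ l, ‖M j l‖₊ :=
    Finset.single_le_sum (f := fun l => ‖M j l‖₊) (fun _ _ => zero_le) (Finset.mem_univ k)
  have h2 := Finset.le_sup (f := fun i => ∑ l, ‖M i l‖₊) (Finset.mem_univ j)
  exact_mod_cast h1.trans h2

theorem norm_le_of_abs_entry_le (M : Matrix J J ℝ) {c : ℝ} (hc : 0 ≤ c)
    (h : ∀ j k, |M j k| ≤ c) : ‖M‖ ≤ Fintype.card J * c := by
  lift c to ℝ≥0 using hc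
  rw [Matrix.linfty_opNorm_def]
  have : (Finset.univ.sup fun i => ∑ l, ‖M i l‖₊) ≤ Fintype.card J * c := by
    refine Finset.sup_le fun i _ => ?_
    refine (Finset.sum_le_card_nsmul _ _ c fun l _ => ?_).trans (by simp)
    exact_mod_cast h i l
  exact_mod_cast this

/-- The Lipschitz constant of partition products with respect to the sup norm of the integrator,
when the total variation is at most `K`. -/
noncomputable def prodConst (K : ℝ) : ℝ := Real.exp K * (2 + 2 * K)

theorem prodConst_mono {a b : ℝ} (ha : 0 ≤ a) (hab : a ≤ b) : prodConst a ≤ prodConst b := by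
  unfold prodConst; gcongr

theorem prodConst_pos {a : ℝ} (ha : 0 ≤ a) : 0 < prodConst a := by
  unfold prodConst; positivity

theorem norm_partitionProd_sub_le [Nonempty J] {A B : ℝ≥0 → Matrix J J ℝ} {v w : ℝ≥0 → ℝ}
    {T : ℝ≥0} (hv : Monotone v) (hw : Monotone w) (hA : ControlledOn T v A)
    (hB : ControlledOn T w B) {d : ℝ} (hd : ∀ s ≤ T, ‖A s - B s‖ ≤ d) {m : ℕ} {u : ℕ → ℝ≥0}
    (hu : Monotone u) (hm : u m ≤ T) :
    ‖partitionProd A u m - partitionProd B u m‖ ≤ prodConst (v T - v 0 + (w T - w 0)) * d := by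
  have hi : ∀ i ≤ m, u i ≤ T := fun i him => (hu him).trans hm
  have hd0 : 0 ≤ d := (norm_nonneg _).trans (hd 0 zero_le)
  have h := norm_prod_sub_prod_le (a := fun i => A (u i)) (b := fun i => B (u i))
    (X := partitionProd A u) (Y := partitionProd B u) (w := fun i => v (u i) + w (u i)) (d := d)
    rfl rfl (m := m) (fun i _ => rfl) (fun i _ => rfl)
    (fun i him => by
      have h1 := hA (u i) (u (i + 1)) (hu i.le_succ) (hi _ him)
      have h2 := hw (hu i.le_succ)
      linarith)
    (fun i him => by
      have h1 := hB (u i) (u (i + 1)) (hu i.le_succ) (hi _ him)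
      have h2 := hv (hu i.le_succ)
      linarith)
    (fun i him => hd _ (hi i him))
  refine h.trans (mul_le_mul_of_nonneg_right (prodConst_mono ?_ ?_) hd0)
  · have h1 := hv (hu m.zero_le)
    have h2 := hw (hu m.zero_le)
    linarith
  · have h1 := hv hm
    have h2 := hw hm
    have h3 := hv (zero_le (a := u 0))
    have h4 := hw (zero_le (a := u 0))
    linarith

/-- The product of `1 + Δβ` over the first `k` steps of the sequence `β`. -/
def levelProd (β : ℕ → Matrix J J ℝ) : ℕ → Matrix J J ℝ
  | 0 => 1
  | k + 1 => levelProd β k * (1 + (β (k + 1) - β k))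

/-- The partition products of a step function depend only on the level reached, provided that the
partition does not skip a level. -/
theorem partitionProd_levels (β : ℕ → Matrix J J ℝ) {N : ℝ≥0 → ℕ} {u : ℕ → ℝ≥0} (hN0 : N (u 0) = 0)
    {m : ℕ} (hN : ∀ i < m, N (u i) ≤ N (u (i + 1)) ∧ N (u (i + 1)) ≤ N (u i) + 1) :
    ∀ i ≤ m, partitionProd (fun s => β (N s)) u i = levelProd β (N (u i)) := by
  intro i
  induction i with
  | zero => intro _; rw [hN0]; rfl
  | succ i ih =>
    intro hi
    rw [partitionProd, ih (by omega)]
    obtain ⟨h1, h2⟩ := hN i hi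
    rcases h1.eq_or_lt with h | h
    · rw [h]; simp
    · have : N (u (i + 1)) = N (u i) + 1 := by omega
      rw [this]; rfl

/-- The partition products of a controlled function over `(0, t]` have the Cauchy property as the
mesh tends to zero. -/
theorem partitionProd_cauchy [Nonempty J] {A : ℝ≥0 → Matrix J J ℝ} {v : ℝ≥0 → ℝ} {T : ℝ≥0}
    (hv : IsControl v) (hA : ControlledOn T v A) {η : ℝ} (hη : 0 < η) :
    ∃ δ : ℝ≥0, 0 < δ ∧ ∀ t ≤ T, ∀ (m : ℕ) (u : ℕ → ℝ≥0) (m' : ℕ) (u' : ℕ → ℝ≥0),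
      Monotone u → u 0 = 0 → u m = t → (∀ i < m, u (i + 1) < u i + δ) →
      Monotone u' → u' 0 = 0 → u' m' = t → (∀ i < m', u' (i + 1) < u' i + δ) →
      ‖partitionProd A u m - partitionProd A u' m'‖ < η := by
  have hK : 0 ≤ v T - v 0 := sub_nonneg.2 (hv.mono zero_le)
  set C := prodConst (v T - v 0 + (v T - v 0)) with hCdef
  have hC : 0 < C := prodConst_pos (by linarith)
  obtain ⟨N, δ, hδ, hN0, hNm, hNgap, hNv⟩ := hv.exists_levels T
    (η := η / (3 * C)) (by positivity)
  -- `c k` is a time in the level `k`, so that `s ↦ A (c (N s))` is a step function close to `A`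
  set c : ℕ → ℝ≥0 := fun k => min (Function.invFun N k) T with hc
  have hNinv : ∀ s, N (Function.invFun N (N s)) = N s := fun s => Function.invFun_eq ⟨s, rfl⟩
  have hNc : ∀ s ≤ T, N (c (N s)) = N s := by
    intro s hs
    rcases le_total (Function.invFun N (N s)) T with h | h
    · simp only [hc, min_eq_left h, hNinv]
    · simp only [hc, min_eq_right h]
      exact le_antisymm ((hNm h).trans (hNinv s).le) (hNm hs)
  have hcT : ∀ k, c k ≤ T := fun k => min_le_right _ _
  have hcm : Monotone fun s => c (N s) := by
    intro s t hst
    rcases (hNm hst).eq_or_lt with h | h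
    · simp only [h]; exact le_rfl
    · refine min_le_min ?_ le_rfl
      by_contra! h'
      have := hNm h'.le
      rw [hNinv, hNinv] at this
      omega
  have hvc : Monotone fun s => v (c (N s)) := hv.mono.comp hcm
  have hB : ControlledOn T (fun s => v (c (N s))) (fun s => A (c (N s))) :=
    fun s t hst _ => hA _ _ (hcm hst) (hcT _)
  have hd : ∀ s ≤ T, ‖A s - A (c (N s))‖ ≤ η / (3 * C) := by
    intro s hs
    rcases le_total (c (N s)) s with h | h
    · exact (hA _ _ h hs).trans (hNv _ _ h hs (hNc s hs)).le
    · rw [norm_sub_rev]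
      exact (hA _ _ h (hcT _)).trans (hNv _ _ h (hcT _) (hNc s hs).symm).le
  have hbd : ∀ (m : ℕ) (u : ℕ → ℝ≥0), Monotone u → u m ≤ T →
      ‖partitionProd A u m - partitionProd (fun s => A (c (N s))) u m‖ ≤ η / 3 := by
    intro m u hu hm
    refine (norm_partitionProd_sub_le hv.mono hvc hA hB hd hu hm).trans ?_
    have h1 : prodConst (v T - v 0 + (v (c (N T)) - v (c (N 0)))) ≤ C := by
      refine prodConst_mono ?_ ?_
      · have := hvc (zero_le (a := T))
        simp only at this
        linarith
      · have h1 := hv.mono (hcT (N T))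
        have h2 := hv.mono (zero_le (a := c (N 0)))
        linarith
    calc _ ≤ C * (η / (3 * C)) := by gcongr
      _ = η / 3 := by field_simp
  have hlev : ∀ (m : ℕ) (u : ℕ → ℝ≥0), Monotone u → u 0 = 0 → (∀ i < m, u (i + 1) < u i + δ) →
      partitionProd (fun s => A (c (N s))) u m = levelProd (fun k => A (c k)) (N (u m)) :=
    fun m u hu h0 hmesh => partitionProd_levels (fun k => A (c k)) (by rw [h0, hN0])
      (fun i hi => ⟨hNm (hu i.le_succ), hNgap _ _ (hmesh i hi)⟩) m le_rfl
  refine ⟨δ, hδ, fun t ht m u m' u' hu hu0 hut hum hu' hu0' hut' hum' => ?_⟩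
  have h1 := hbd m u hu (hut.trans_le ht)
  have h2 := hbd m' u' hu' (hut'.trans_le ht)
  rw [hlev m u hu hu0 hum, hut] at h1
  rw [hlev m' u' hu' hu0' hum', hut', norm_sub_rev] at h2
  have h3 := norm_sub_le_norm_sub_add_norm_sub (partitionProd A u m)
    (levelProd (fun k => A (c k)) (N t)) (partitionProd A u' m')
  linarith

/-- The points `t i / (n + 1)` of the partition of `[0, t]` into `n + 1` intervals of equal
length. -/
noncomputable def uniformPartition (t : ℝ≥0) (n i : ℕ) : ℝ≥0 := t * i / (n + 1)

theorem uniformPartition_mono (t : ℝ≥0) (n : ℕ) : Monotone (uniformPartition t n) := by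
  intro i j hij
  unfold uniformPartition
  gcongr

theorem uniformPartition_zero (t : ℝ≥0) (n : ℕ) : uniformPartition t n 0 = 0 := by
  simp [uniformPartition]

theorem uniformPartition_end (t : ℝ≥0) (n : ℕ) : uniformPartition t n (n + 1) = t := by
  unfold uniformPartition; push_cast; field_simp

theorem eventually_uniformPartition_mesh (t : ℝ≥0) {δ : ℝ≥0} (hδ : 0 < δ) :
    ∀ᶠ n in atTop, ∀ i, uniformPartition t n (i + 1) < uniformPartition t n i + δ := by
  have h : Tendsto (fun n : ℕ => (t : ℝ) / ((n : ℝ) + 1)) atTop (𝓝 0) := by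
    simpa [div_eq_mul_inv] using
      (tendsto_one_div_add_atTop_nhds_zero_nat (𝕜 := ℝ)).const_mul (t : ℝ)
  filter_upwards [h.eventually (gt_mem_nhds (show (0 : ℝ) < δ from hδ))] with n hn i
  rw [← NNReal.coe_lt_coe]
  unfold uniformPartition
  push_cast
  calc (t : ℝ) * (i + 1) / (n + 1) = t * i / (n + 1) + t / (n + 1) := by ring
    _ < _ := by linarith

theorem IsProdInt.tendsto {A : ℝ≥0 → Matrix J J ℝ} {t : ℝ≥0} {M : Matrix J J ℝ}
    (h : IsProdInt A t M) (j k : J) :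
    Tendsto (fun n => partitionProd A (uniformPartition t n) (n + 1) j k) atTop (𝓝 (M j k)) := by
  rw [Metric.tendsto_atTop']
  intro η hη
  obtain ⟨δ, hδ, hM⟩ := h η hη
  obtain ⟨n₀, hn₀⟩ := eventually_atTop.1 (eventually_uniformPartition_mesh t hδ)
  exact ⟨n₀, fun n hn => hM (n + 1) _ (uniformPartition_mono t n) (uniformPartition_zero t n)
    (uniformPartition_end t n) (fun i _ => hn₀ n hn.le i) j k⟩

theorem exists_isProdInt [Nonempty J] {A : ℝ≥0 → Matrix J J ℝ} {v : ℝ≥0 → ℝ} {T : ℝ≥0}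
    (hv : IsControl v) (hA : ControlledOn T v A) {t : ℝ≥0} (ht : t ≤ T) :
    ∃ M, IsProdInt A t M := by
  set P : ℕ → Matrix J J ℝ := fun n => partitionProd A (uniformPartition t n) (n + 1) with hP
  have hlim : ∀ j k, ∃ x, Tendsto (fun n => P n j k) atTop (𝓝 x) := by
    intro j k
    refine cauchySeq_tendsto_of_complete (Metric.cauchySeq_iff.2 fun η hη => ?_)
    obtain ⟨δ, hδ, hc⟩ := partitionProd_cauchy hv hA hη
    obtain ⟨n₀, hn₀⟩ := eventually_atTop.1 (eventually_uniformPartition_mesh t hδ)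
    refine ⟨n₀, fun n hn n' hn' => ?_⟩
    refine (abs_entry_le_norm (P n - P n') j k).trans_lt ?_
    exact hc t ht _ _ _ _ (uniformPartition_mono t n) (uniformPartition_zero t n)
      (uniformPartition_end t n) (fun i _ => hn₀ n hn i) (uniformPartition_mono t n')
      (uniformPartition_zero t n') (uniformPartition_end t n') (fun i _ => hn₀ n' hn' i)
  choose M hM using hlim
  refine ⟨Matrix.of M, fun η hη => ?_⟩
  obtain ⟨δ, hδ, hc⟩ := partitionProd_cauchy hv hA (half_pos hη)
  refine ⟨δ, hδ, fun m u hu hu0 hut hum j k => lt_of_le_of_lt ?_ (half_lt_self hη)⟩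
  have h1 : Tendsto (fun n => |partitionProd A u m j k - P n j k|) atTop
      (𝓝 |partitionProd A u m j k - M j k|) := (tendsto_const_nhds.sub (hM j k)).abs
  refine le_of_tendsto h1 ?_
  filter_upwards [eventually_uniformPartition_mesh t hδ] with n hn
  refine (abs_entry_le_norm (partitionProd A u m - P n) j k).trans ?_
  exact (hc t ht _ _ _ _ hu hu0 hut hum (uniformPartition_mono t n)
      (uniformPartition_zero t n) (uniformPartition_end t n) (fun i _ => hn i)).le

theorem prodInt_spec {A : ℝ≥0 → Matrix J J ℝ} {t : ℝ≥0} (h : ∃ M, IsProdInt A t M) :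
    IsProdInt A t (prodInt A t) := by
  rw [prodInt, dif_pos h]; exact h.choose_spec

theorem abs_prodInt_sub_le [Nonempty J] {A B : ℝ≥0 → Matrix J J ℝ} {v w : ℝ≥0 → ℝ} {T : ℝ≥0}
    (hv : IsControl v) (hw : IsControl w) (hA : ControlledOn T v A) (hB : ControlledOn T w B)
    {d : ℝ} (hd : ∀ s ≤ T, ‖A s - B s‖ ≤ d) {t : ℝ≥0} (ht : t ≤ T) (j k : J) :
    |prodInt A t j k - prodInt B t j k| ≤ prodConst (v T - v 0 + (w T - w 0)) * d := by
  have h1 := (prodInt_spec (exists_isProdInt hv hA ht)).tendsto j k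
  have h2 := (prodInt_spec (exists_isProdInt hw hB ht)).tendsto j k
  refine le_of_tendsto (h1.sub h2).abs (Eventually.of_forall fun n => ?_)
  refine (abs_entry_le_norm (partitionProd A _ _ - partitionProd B _ _) j k).trans ?_
  exact norm_partitionProd_sub_le hv.mono hw.mono hA hB hd (uniformPartition_mono t n)
    ((uniformPartition_end t n).trans_le ht)

end Product

/-! ### Perturbed hazards -/

theorem lsMeasure_Ioc {N : ℝ≥0 → ℝ} (hN : IsControl N) (a b : ℝ≥0) :
    lsMeasure N (Set.Ioc a b) = ENNReal.ofReal (N b - N a) := by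
  have h : ∀ x, hN.mono.stieltjesFunction x = N x := fun x => by
    rw [Monotone.stieltjesFunction_eq]
    exact ContinuousWithinAt.rightLim_eq (hN.rightCont x)
  rw [lsMeasure, dif_pos hN.mono, StieltjesFunction.measure_Ioc, h, h]

theorem lsMeasure_real_Ioc {N : ℝ≥0 → ℝ} (hN : IsControl N) {a b : ℝ≥0} (hab : a ≤ b) :
    (lsMeasure N).real (Set.Ioc a b) = N b - N a := by
  rw [Measure.real, lsMeasure_Ioc hN, ENNReal.toReal_ofReal (sub_nonneg.2 (hN.mono hab))]

theorem abs_one_div_max_sub_le {ε : ℝ} (hε : 0 < ε) (a b : ℝ) :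
    |1 / max a ε - 1 / max b ε| ≤ |a - b| / ε ^ 2 := by
  have ha : ε ≤ max a ε := le_max_right _ _
  have hb : ε ≤ max b ε := le_max_right _ _
  have ha0 := hε.trans_le ha
  have hb0 := hε.trans_le hb
  rw [div_sub_div _ _ ha0.ne' hb0.ne', abs_div, one_mul, mul_one, abs_of_pos (mul_pos ha0 hb0)]
  refine div_le_div₀ (abs_nonneg _) ?_ (by positivity) (by nlinarith)
  rw [abs_sub_comm a b]
  exact abs_max_sub_max_le_abs _ _ _

theorem one_div_max_nonneg {ε : ℝ} (hε : 0 < ε) (a : ℝ) : 0 ≤ 1 / max a ε :=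
  one_div_nonneg.2 (hε.le.trans (le_max_right _ _))

theorem one_div_max_le {ε : ℝ} (hε : 0 < ε) (a : ℝ) : 1 / max a ε ≤ 1 / ε :=
  one_div_le_one_div_of_le hε (le_max_right _ _)

section Hazard

variable {ε : ℝ} {I N : ℝ≥0 → ℝ}

theorem isFiniteMeasure_restrict_Ioc (hN : IsControl N) (a b : ℝ≥0) :
    IsFiniteMeasure ((lsMeasure N).restrict (Set.Ioc a b)) :=
  ⟨by rw [Measure.restrict_apply_univ, lsMeasure_Ioc hN]; exact ENNReal.ofReal_lt_top⟩

theorem measurable_hazardIntegrand (hI : ∀ s, ∃ L, Tendsto I (𝓝[<] s) (𝓝 L)) :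
    Measurable fun s => 1 / max (Function.leftLim I s) ε :=
  measurable_const.div ((measurable_leftLim hI).max measurable_const)

theorem integrableOn_hazardIntegrand (hε : 0 < ε) (hI : ∀ s, ∃ L, Tendsto I (𝓝[<] s) (𝓝 L))
    (hN : IsControl N) (a b : ℝ≥0) :
    IntegrableOn (fun s => 1 / max (Function.leftLim I s) ε) (Set.Ioc a b) (lsMeasure N) := by
  have := isFiniteMeasure_restrict_Ioc hN a b
  refine Integrable.of_bound (measurable_hazardIntegrand hI).aestronglyMeasurable (1 / ε)
    (Eventually.of_forall fun s => ?_)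
  rw [Real.norm_eq_abs, abs_of_nonneg (one_div_max_nonneg hε _)]
  exact one_div_max_le hε _

theorem perturbedHazard_eq_add (hε : 0 < ε) (hI : ∀ s, ∃ L, Tendsto I (𝓝[<] s) (𝓝 L))
    (hN : IsControl N) {s t : ℝ≥0} (hst : s ≤ t) :
    perturbedHazard ε I N t = perturbedHazard ε I N s +
      ∫ x in Set.Ioc s t, 1 / max (Function.leftLim I x) ε ∂(lsMeasure N) := by
  unfold perturbedHazard
  rw [← Set.Ioc_union_Ioc_eq_Ioc (zero_le (a := s)) hst,
    setIntegral_union (Set.Ioc_disjoint_Ioc_of_le le_rfl) measurableSet_Ioc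
    (integrableOn_hazardIntegrand hε hI hN _ _) (integrableOn_hazardIntegrand hε hI hN _ _)]

theorem perturbedHazard_controlledOn (hε : 0 < ε) (hI : ∀ s, ∃ L, Tendsto I (𝓝[<] s) (𝓝 L))
    (hN : IsControl N) {T : ℝ≥0} {v : ℝ≥0 → ℝ} (hv : ControlledOn T v N) :
    ControlledOn T (fun t => 1 / ε * v t) (perturbedHazard ε I N) := by
  intro s t hst htT
  have := isFiniteMeasure_restrict_Ioc hN s t
  rw [perturbedHazard_eq_add hε hI hN hst, add_sub_cancel_left, ← mul_sub]
  refine (norm_setIntegral_le_of_norm_le_const (C := 1 / ε) (by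
    rw [lsMeasure_Ioc hN]; exact ENNReal.ofReal_lt_top) (fun x _ => ?_)).trans ?_
  · rw [Real.norm_eq_abs, abs_of_nonneg (one_div_max_nonneg hε _)]
    exact one_div_max_le hε _
  · rw [lsMeasure_real_Ioc hN hst]
    have := (le_abs_self _).trans (hv s t hst htT)
    have h : 0 < 1 / ε := by positivity
    gcongr

/-- If `f` is within `γ` of the constant `c`, its integrals against two Lebesgue–Stieltjes measures
differ by little when the distribution functions are uniformly close. -/
theorem abs_setIntegral_sub_le {f : ℝ≥0 → ℝ} {N N' : ℝ≥0 → ℝ} (hN : IsControl N)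
    (hN' : IsControl N') {s t : ℝ≥0} (hst : s ≤ t) (hf : IntegrableOn f (Set.Ioc s t) (lsMeasure N))
    (hf' : IntegrableOn f (Set.Ioc s t) (lsMeasure N')) {c γ d : ℝ}
    (hc : ∀ x ∈ Set.Ioc s t, |f x - c| ≤ γ) (hs : |N s - N' s| ≤ d) (ht : |N t - N' t| ≤ d) :
    |∫ x in Set.Ioc s t, f x ∂(lsMeasure N) - ∫ x in Set.Ioc s t, f x ∂(lsMeasure N')| ≤
      |c| * (2 * d) + γ * ((N t - N s) + (N' t - N' s)) := by
  have key : ∀ {N : ℝ≥0 → ℝ}, IsControl N → IntegrableOn f (Set.Ioc s t) (lsMeasure N) →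
      |∫ x in Set.Ioc s t, f x ∂(lsMeasure N) - c * (N t - N s)| ≤ γ * (N t - N s) := by
    intro N hN hf
    have := isFiniteMeasure_restrict_Ioc hN s t
    have h1 : ∫ x in Set.Ioc s t, (f x - c) ∂(lsMeasure N) =
        ∫ x in Set.Ioc s t, f x ∂(lsMeasure N) - c * (N t - N s) := by
      rw [integral_sub hf (integrable_const c), setIntegral_const, lsMeasure_real_Ioc hN hst,
        smul_eq_mul, mul_comm c]
    rw [← h1, ← lsMeasure_real_Ioc hN hst, ← Real.norm_eq_abs]
    exact norm_setIntegral_le_of_norm_le_const (by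
      rw [lsMeasure_Ioc hN]; exact ENNReal.ofReal_lt_top) hc
  have h1 := key hN hf
  have h2 := key hN' hf'
  have h3 : |c * (N t - N s) - c * (N' t - N' s)| ≤ |c| * (2 * d) := by
    rw [← mul_sub, abs_mul]
    refine mul_le_mul_of_nonneg_left ?_ (abs_nonneg _)
    rw [abs_le] at *
    constructor <;> linarith
  rw [abs_le] at *
  constructor <;> linarith

/-- Stability in the integrator.  The number `k` of intervals on which the integrand varies by at
most `η / ε ^ 2` depends only on the exposure `I`, not on the integrators. -/
theorem exists_abs_perturbedHazard_sub_le (hε : 0 < ε)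
    (hI : ∀ s, ∃ L, Tendsto I (𝓝[<] s) (𝓝 L)) {v : ℝ≥0 → ℝ} (hv : IsControl v) {T : ℝ≥0}
    (hIv : ControlledOn T v I) {η : ℝ} (hη : 0 < η) :
    ∃ k : ℕ, ∀ N N' : ℝ≥0 → ℝ, IsControl N → IsControl N' → ∀ d : ℝ,
      (∀ s ≤ T, |N s - N' s| ≤ d) → ∀ t ≤ T,
      |perturbedHazard ε I N t - perturbedHazard ε I N' t| ≤
        k * (1 / ε * (2 * d)) + η / ε ^ 2 * ((N T - N 0) + (N' T - N' 0)) := by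
  classical
  obtain ⟨X, hX⟩ := hv.exists_finset T hη
  refine ⟨X.card + 1, fun N N' hN hN' d hd => ?_⟩
  have hd0 : 0 ≤ d := (abs_nonneg _).trans (hd 0 zero_le)
  have key : ∀ x t, x ≤ t → t ≤ T → (∀ y ∈ X, x < y → t ≤ y) →
      |∫ x in Set.Ioc x t, 1 / max (Function.leftLim I x) ε ∂(lsMeasure N) -
        ∫ x in Set.Ioc x t, 1 / max (Function.leftLim I x) ε ∂(lsMeasure N')| ≤
      1 / ε * (2 * d) + η / ε ^ 2 * ((N t - N x) + (N' t - N' x)) := by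
    intro x t hxt htT hy
    refine (abs_setIntegral_sub_le hN hN' hxt (integrableOn_hazardIntegrand hε hI hN _ _)
      (integrableOn_hazardIntegrand hε hI hN' _ _) (c := 1 / max (I x) ε) (γ := η / ε ^ 2)
      (fun s hs => ?_) (hd _ (hxt.trans htT)) (hd _ htT)).trans ?_
    · refine (abs_one_div_max_sub_le hε _ _).trans ?_
      gcongr
      have hs0 : 0 < s := (zero_le).trans_lt hs.1
      have : (𝓝[<] s).NeBot := nhdsLT_neBot_of_exists_lt ⟨0, hs0⟩
      refine le_of_tendsto ((tendsto_leftLim_of_exists (hI s)).sub_const (I x)).abs ?_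
      filter_upwards [Ioo_mem_nhdsLT hs.1] with y hy'
      have hyT := (hy'.2.le.trans hs.2).trans htT
      exact (hIv x y hy'.1.le hyT).trans (hX x y hy'.1.le hyT fun x' hx' hxx' =>
        hy'.2.trans_le (hs.2.trans (hy x' hx' hxx'))).le
    · gcongr
      rw [abs_of_nonneg (one_div_max_nonneg hε _)]
      exact one_div_max_le hε _
  -- induction on the number of points of `X` before `t`, splitting at the last one
  have ind : ∀ k : ℕ, ∀ t ≤ T, (X.filter (fun x => 0 < x ∧ x < t)).card = k →
      |perturbedHazard ε I N t - perturbedHazard ε I N' t| ≤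
        ((k + 1 : ℕ) : ℝ) * (1 / ε * (2 * d)) +
          η / ε ^ 2 * ((N t - N 0) + (N' t - N' 0)) := by
    intro k
    induction k using Nat.strong_induction_on with
    | _ k ih =>
      intro t ht hk
      set S := X.filter (fun x => 0 < x ∧ x < t) with hS
      rcases S.eq_empty_or_nonempty with hSe | hSn
      · rw [hSe, Finset.card_empty] at hk
        subst hk
        have h := key 0 t zero_le ht fun y hy hy0 => by
          by_contra! hyt
          have : y ∈ S := Finset.mem_filter.2 ⟨hy, hy0, hyt⟩
          rw [hSe] at this
          simp at this
        simpa [perturbedHazard] using h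
      · set x := S.max' hSn with hx
        have hxS : x ∈ S := S.max'_mem hSn
        obtain ⟨-, hx0, hxt⟩ := Finset.mem_filter.1 hxS
        have hcard : (X.filter (fun y => 0 < y ∧ y < x)).card < k := by
          rw [← hk]
          refine Finset.card_lt_card (Finset.ssubset_iff_of_subset ?_ |>.2 ⟨x, hxS, by simp⟩)
          intro y hy
          rw [Finset.mem_filter] at hy
          exact Finset.mem_filter.2 ⟨hy.1, hy.2.1, hy.2.2.trans hxt⟩
        have h1 := ih _ hcard x (hxt.le.trans ht) rfl
        have h2 := key x t hxt.le ht fun y hy hxy => by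
          by_contra! hyt
          exact (S.le_max' y (Finset.mem_filter.2 ⟨hy, hx0.trans hxy, hyt⟩)).not_gt hxy
        rw [perturbedHazard_eq_add hε hI hN hxt.le, perturbedHazard_eq_add hε hI hN' hxt.le]
        have h3 : (((X.filter (fun y => 0 < y ∧ y < x)).card + 1 : ℕ) : ℝ) * (1 / ε * (2 * d)) ≤
            k * (1 / ε * (2 * d)) := by
          have : (0 : ℝ) ≤ 1 / ε * (2 * d) := by positivity
          exact mul_le_mul_of_nonneg_right (by exact_mod_cast hcard) this
        push_cast at h3 ⊢
        push_cast at h1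
        rw [abs_le] at *
        constructor <;> linarith
  intro t ht
  refine (ind _ t ht rfl).trans (add_le_add ?_ ?_)
  · have : (X.filter (fun x => 0 < x ∧ x < t)).card ≤ X.card := Finset.card_filter_le _ _
    gcongr
  · have h1 := hN.mono ht
    have h2 := hN'.mono ht
    gcongr

/-- Stability in the exposure. -/
theorem abs_perturbedHazard_sub_le (hε : 0 < ε) {I' : ℝ≥0 → ℝ}
    (hI : ∀ s, ∃ L, Tendsto I (𝓝[<] s) (𝓝 L)) (hI' : ∀ s, ∃ L, Tendsto I' (𝓝[<] s) (𝓝 L))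
    (hN : IsControl N) {T : ℝ≥0} {d : ℝ} (hd : ∀ s ≤ T, |I s - I' s| ≤ d) {t : ℝ≥0} (ht : t ≤ T) :
    |perturbedHazard ε I N t - perturbedHazard ε I' N t| ≤ d / ε ^ 2 * (N T - N 0) := by
  have hd0 : 0 ≤ d := (abs_nonneg _).trans (hd 0 zero_le)
  unfold perturbedHazard
  rw [← integral_sub (integrableOn_hazardIntegrand hε hI hN _ _)
    (integrableOn_hazardIntegrand hε hI' hN _ _), ← Real.norm_eq_abs]
  refine (norm_setIntegral_le_of_norm_le_const (C := d / ε ^ 2) (by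
    rw [lsMeasure_Ioc hN]; exact ENNReal.ofReal_lt_top) (fun s hs => ?_)).trans ?_
  · refine (abs_one_div_max_sub_le hε _ _).trans ?_
    gcongr
    have : (𝓝[<] s).NeBot := nhdsLT_neBot_of_exists_lt ⟨0, hs.1⟩
    refine le_of_tendsto ((tendsto_leftLim_of_exists (hI s)).sub
      (tendsto_leftLim_of_exists (hI' s))).abs ?_
    filter_upwards [self_mem_nhdsWithin] with y hy
    exact hd y ((Set.mem_Iio.1 hy).le.trans (hs.2.trans ht))
  · rw [lsMeasure_real_Ioc hN zero_le]
    have h1 := hN.mono ht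
    gcongr

/-- The perturbed hazard is continuous in the exposure and the integrator, for uniform
convergence. -/
theorem tendstoUniformlyOn_perturbedHazard (hε : 0 < ε) {In Nn : ℕ → ℝ≥0 → ℝ}
    (hIn : ∀ n s, ∃ L, Tendsto (In n) (𝓝[<] s) (𝓝 L))
    (hI : ∀ s, ∃ L, Tendsto I (𝓝[<] s) (𝓝 L)) (hNn : ∀ n, IsControl (Nn n)) (hN : IsControl N)
    {v : ℝ≥0 → ℝ} (hv : IsControl v) {T : ℝ≥0} (hIv : ControlledOn T v I)
    (hIc : TendstoUniformlyOn In I atTop (Set.Icc 0 T))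
    (hNc : TendstoUniformlyOn Nn N atTop (Set.Icc 0 T)) :
    TendstoUniformlyOn (fun n => perturbedHazard ε (In n) (Nn n)) (perturbedHazard ε I N) atTop
      (Set.Icc 0 T) := by
  rw [Metric.tendstoUniformlyOn_iff] at *
  intro e he
  have hM0 : 0 ≤ N T - N 0 := sub_nonneg.2 (hN.mono zero_le)
  set M := N T - N 0 + 1 with hM
  have hMpos : 0 < M := by linarith
  obtain ⟨k, hk⟩ := exists_abs_perturbedHazard_sub_le hε hI hv hIv
    (η := e * ε ^ 2 / (8 * M)) (by positivity)
  set d : ℝ := min (1 / 2) (min (e / 4 / (k * (1 / ε * 2) + 1)) (e * ε ^ 2 / (4 * M))) with hd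
  have hd0 : 0 < d := by positivity
  have hd1 : d ≤ 1 / 2 := min_le_left _ _
  have hd2 : k * (1 / ε * (2 * d)) ≤ e / 4 := by
    have : d ≤ e / 4 / (k * (1 / ε * 2) + 1) := (min_le_right _ _).trans (min_le_left _ _)
    rw [le_div_iff₀ (by positivity)] at this
    linarith
  have hd3 : d / ε ^ 2 * M ≤ e / 4 := by
    have : d ≤ e * ε ^ 2 / (4 * M) := (min_le_right _ _).trans (min_le_right _ _)
    calc d / ε ^ 2 * M ≤ e * ε ^ 2 / (4 * M) / ε ^ 2 * M := by gcongr
      _ = e / 4 := by field_simp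
  filter_upwards [hIc d hd0, hNc d hd0] with n h1 h2 t ht
  have h1' : ∀ s ≤ T, |In n s - I s| ≤ d := fun s hs => by
    have := h1 s ⟨zero_le, hs⟩
    rw [dist_comm, Real.dist_eq] at this
    exact this.le
  have h2' : ∀ s ≤ T, |Nn n s - N s| ≤ d := fun s hs => by
    have := h2 s ⟨zero_le, hs⟩
    rw [dist_comm, Real.dist_eq] at this
    exact this.le
  have h3 : Nn n T - Nn n 0 ≤ M := by
    have a := abs_le.1 (h2' T le_rfl)
    have b := abs_le.1 (h2' 0 zero_le)
    linarith
  have h4 := hk _ _ (hNn n) hN d h2' t ht.2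
  have h5 := abs_perturbedHazard_sub_le hε (hIn n) hI (hNn n) h1' ht.2
  have h6 : d / ε ^ 2 * (Nn n T - Nn n 0) ≤ e / 4 := le_trans (by gcongr) hd3
  have h7 : e * ε ^ 2 / (8 * M) / ε ^ 2 * (Nn n T - Nn n 0 + (N T - N 0)) ≤ e / 4 := by
    calc _ ≤ e * ε ^ 2 / (8 * M) / ε ^ 2 * (M + M) := by gcongr; linarith
      _ = e / 4 := by field_simp; norm_num
  rw [dist_comm, Real.dist_eq]
  have h8 := abs_sub_le (perturbedHazard ε (In n) (Nn n) t) (perturbedHazard ε I (Nn n) t)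
    (perturbedHazard ε I N t)
  linarith

end Hazard

/-! ### Hazard matrices and their product integrals -/

section Matrices

open scoped Matrix.Norms.Operator

variable {J : Type*} [Fintype J]

/-- A control of the matrix of perturbed hazards, for the operator norm induced by the sup norm,
when `w` controls the transition processes: each entry off the diagonal is controlled by `w / ε`,
hence each entry by `#J * w / ε`. -/
noncomputable def hazardControl (J : Type*) [Fintype J] (ε : ℝ) (w : ℝ≥0 → ℝ) (t : ℝ≥0) : ℝ :=
  Fintype.card J * (Fintype.card J * (1 / ε * w t))

theorem isControl_hazardControl {ε : ℝ} (hε : 0 < ε) {w : ℝ≥0 → ℝ} (hw : IsControl w) :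
    IsControl (hazardControl J ε w) :=
  ((hw.const_mul (by positivity)).const_mul (by positivity)).const_mul (by positivity)

variable [DecidableEq J]

theorem hazardMatrix_controlledOn (J₁ : Set J) {L L' : J → J → ℝ≥0 → ℝ} {T : ℝ≥0} {w : ℝ≥0 → ℝ}
    (hw : Monotone w) (hL : ∀ j k, j ≠ k → ControlledOn T w (L j k))
    (hL' : ∀ j k, j ≠ k → ControlledOn T w (L' j k)) :
    ControlledOn T (fun t => Fintype.card J * (Fintype.card J * w t)) (hazardMatrix J₁ L L') := by
  classical
  intro s t hst htT
  rw [← mul_sub, ← mul_sub]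
  have h0 : 0 ≤ w t - w s := sub_nonneg.2 (hw hst)
  refine norm_le_of_abs_entry_le _ (by positivity) fun j k => ?_
  have hcard : (1 : ℝ) ≤ Fintype.card J := by
    exact_mod_cast Fintype.card_pos_iff.2 ⟨j⟩
  have hrow : ∀ M : J → J → ℝ≥0 → ℝ, (∀ j k, j ≠ k → ControlledOn T w (M j k)) →
      |-∑ l ∈ Finset.univ.erase j, M j l t - -∑ l ∈ Finset.univ.erase j, M j l s| ≤
        Fintype.card J * (w t - w s) := by
    intro M hM
    rw [neg_sub_neg, ← Finset.sum_sub_distrib]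
    refine (Finset.abs_sum_le_sum_abs _ _).trans ?_
    refine (Finset.sum_le_card_nsmul _ _ (w t - w s) fun l hl => ?_).trans ?_
    · rw [abs_sub_comm]
      exact hM j l (Finset.ne_of_mem_erase hl).symm s t hst htT
    · rw [nsmul_eq_mul]
      exact mul_le_mul_of_nonneg_right (by exact_mod_cast Finset.card_le_univ _) h0
  rw [Matrix.sub_apply]
  simp only [hazardMatrix, Matrix.of_apply]
  split_ifs with h1 h2
  · refine (hL j k h1 s t hst htT).trans ?_
    nlinarith
  · convert hrow L hL
  · convert hrow L' hL'

theorem tendstoUniformlyOn_hazardMatrix (J₁ : Set J) {Ln Ln' : ℕ → J → J → ℝ≥0 → ℝ}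
    {L L' : J → J → ℝ≥0 → ℝ} {S : Set ℝ≥0}
    (h : ∀ j k, j ≠ k → TendstoUniformlyOn (fun n => Ln n j k) (L j k) atTop S)
    (h' : ∀ j k, j ≠ k → TendstoUniformlyOn (fun n => Ln' n j k) (L' j k) atTop S) (j k : J) :
    TendstoUniformlyOn (fun n t => hazardMatrix J₁ (Ln n) (Ln' n) t j k)
      (fun t => hazardMatrix J₁ L L' t j k) atTop S := by
  classical
  have hrow : ∀ (Mn : ℕ → J → J → ℝ≥0 → ℝ) (M : J → J → ℝ≥0 → ℝ),
      (∀ j k, j ≠ k → TendstoUniformlyOn (fun n => Mn n j k) (M j k) atTop S) →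
      TendstoUniformlyOn (fun n t => -∑ l ∈ Finset.univ.erase j, Mn n j l t)
        (fun t => -∑ l ∈ Finset.univ.erase j, M j l t) atTop S := by
    intro Mn M hM
    have key : ∀ s : Finset J, j ∉ s → TendstoUniformlyOn (fun n t => ∑ l ∈ s, Mn n j l t)
        (fun t => ∑ l ∈ s, M j l t) atTop S := by
      intro s
      induction s using Finset.induction_on with
      | empty =>
        exact fun _ => Metric.tendstoUniformlyOn_iff.2 fun e he =>
          Eventually.of_forall fun n t _ => by simpa using he
      | insert a s ha ih =>
        intro hj
        rw [Finset.mem_insert, not_or] at hj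
        simp only [Finset.sum_insert ha]
        exact (hM j a hj.1).add (ih hj.2)
    exact (key _ (Finset.notMem_erase _ _)).neg
  simp only [hazardMatrix, Matrix.of_apply]
  split_ifs with h1 h2
  · exact h j k h1
  · convert hrow Ln L h
  · convert hrow Ln' L' h'

theorem tendstoUniformlyOn_prodInt [Nonempty J] {An : ℕ → ℝ≥0 → Matrix J J ℝ}
    {A : ℝ≥0 → Matrix J J ℝ} {wn : ℕ → ℝ≥0 → ℝ} {w : ℝ≥0 → ℝ} {T : ℝ≥0}
    (hwn : ∀ n, IsControl (wn n)) (hw : IsControl w) (hAn : ∀ n, ControlledOn T (wn n) (An n))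
    (hA : ControlledOn T w A) (hT : Tendsto (fun n => wn n T) atTop (𝓝 (w T)))
    (h0 : Tendsto (fun n => wn n 0) atTop (𝓝 (w 0)))
    (h : ∀ j k, TendstoUniformlyOn (fun n t => An n t j k) (fun t => A t j k) atTop
      (Set.Icc 0 T)) (j k : J) :
    TendstoUniformlyOn (fun n t => prodInt (An n) t j k) (fun t => prodInt A t j k) atTop
      (Set.Icc 0 T) := by
  rw [Metric.tendstoUniformlyOn_iff]
  intro e he
  have hwT : 0 ≤ w T - w 0 := sub_nonneg.2 (hw.mono zero_le)
  set K := w T - w 0 + 1 + (w T - w 0) with hK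
  have hC : 0 < prodConst K := prodConst_pos (by linarith)
  have hcard : (0 : ℝ) < Fintype.card J := by exact_mod_cast Fintype.card_pos
  set d : ℝ := e / (2 * prodConst K * Fintype.card J) with hd
  have hd0 : 0 < d := by positivity
  have h1 : ∀ᶠ n in atTop, wn n T - wn n 0 < w T - w 0 + 1 :=
    (hT.sub h0).eventually (gt_mem_nhds (lt_add_one _))
  have h2 : ∀ᶠ n in atTop, ∀ j k, ∀ t ∈ Set.Icc 0 T, dist (A t j k) (An n t j k) < d :=
    eventually_all.2 fun j => eventually_all.2 fun k =>
      Metric.tendstoUniformlyOn_iff.1 (h j k) d hd0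
  filter_upwards [h1, h2] with n h1 h2 t ht
  have h3 : ∀ s ≤ T, ‖An n s - A s‖ ≤ Fintype.card J * d := fun s hs =>
    norm_le_of_abs_entry_le _ hd0.le fun j k => by
      have := h2 j k s ⟨zero_le, hs⟩
      rw [dist_comm, Real.dist_eq] at this
      exact this.le
  have h4 := abs_prodInt_sub_le (hwn n) hw (hAn n) hA h3 ht.2 j k
  rw [dist_comm, Real.dist_eq]
  refine h4.trans_lt ?_
  have h5 : 0 ≤ wn n T - wn n 0 := sub_nonneg.2 ((hwn n).mono zero_le)
  calc _ ≤ prodConst K * (Fintype.card J * d) := by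
        refine mul_le_mul_of_nonneg_right (prodConst_mono (by linarith) (by linarith))
          (by positivity)
    _ = e / 2 := by rw [hd]; field_simp
    _ < e := half_lt_self he

end Matrices

/-! ### Paths of jump processes -/

namespace JumpPath

section Paths

variable {J : Type*} [TopologicalSpace J]

theorem tendsto_left (z : JumpPath J) (t : ℝ≥0) : Tendsto z (𝓝[<] t) (𝓝 (z.left t)) :=
  tendsto_leftLim_of_exists (z.2.2 t)

/-- The set of jump times of a path. -/
def jumps (z : JumpPath J) : Set ℝ≥0 := {s | 0 < s ∧ z.left s ≠ z s}

theorem jumpTimes_subset (z : JumpPath J) {j k : J} (hjk : j ≠ k) : z.jumpTimes j k ⊆ z.jumps :=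
  fun _ ⟨h0, h1, h2⟩ => ⟨h0, by rw [h1, h2]; exact hjk⟩

/-- Up to time `T`, the scaling factors take values in `[0, K]`.  Moreover `1 ≤ K`, so that `K` also
bounds the scaling process. -/
structure ScalingBound (ρ : ℝ≥0 → J → J → JumpPath J → ℝ) (T : ℝ≥0) (K : ℝ) : Prop where
  one_le : 1 ≤ K
  nonneg : ∀ t j k z, 0 ≤ ρ t j k z
  le : ∀ t ≤ T, ∀ j k z, ρ t j k z ≤ K

theorem scaling_nonneg {ρ : ℝ≥0 → J → J → JumpPath J → ℝ} (hρ : ∀ t j k z, 0 ≤ ρ t j k z)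
    (J₁ : Set J) (z : JumpPath J) (t : ℝ≥0) : 0 ≤ z.scaling ρ J₁ t := by
  unfold scaling
  split_ifs
  exacts [hρ _ _ _ _, zero_le_one]

theorem transitions_eq_countIntegral (ρ : ℝ≥0 → J → J → JumpPath J → ℝ) (J₁ : Set J)
    (z : JumpPath J) (j k : J) (t r : ℝ≥0) :
    z.transitions ρ J₁ j k t r = z.countIntegral j k (z.scaling ρ J₁) (min t r) := by
  unfold transitions countIntegral
  rw [finsum_mem_def, finsum_mem_def]
  congr 1
  ext s
  by_cases h1 : s ∈ z.jumpTimes j k <;> by_cases h2 : s ≤ t <;> by_cases h3 : s ≤ r <;>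
    simp [Set.indicator, h1, h2, h3]

theorem transitions_zero (ρ : ℝ≥0 → J → J → JumpPath J → ℝ) (J₁ : Set J) (j k : J)
    (z : JumpPath J) (r : ℝ≥0) : z.transitions ρ J₁ j k 0 r = 0 := by
  unfold transitions countIntegral
  have : z.jumpTimes j k ∩ Set.Iic 0 = ∅ :=
    Set.eq_empty_of_forall_notMem fun x hx => hx.1.1.not_ge hx.2
  rw [this, finsum_mem_empty]

theorem count_eq_of_no_jump (z : JumpPath J) {j k : J} (hjk : j ≠ k) {s t : ℝ≥0}
    (hst : s ≤ t) (h : ∀ x ∈ Set.Ioc s t, x ∉ z.jumps) :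
    z.count j k s = z.count j k t := by
  unfold count
  congr 1
  ext x
  refine and_congr_right fun hx => ⟨fun hxs => le_trans hxs hst, fun hxt => ?_⟩
  by_contra hxs
  exact h x ⟨not_le.1 hxs, hxt⟩ (z.jumpTimes_subset hjk hx)

theorem ScalingBound.scaling_le {ρ : ℝ≥0 → J → J → JumpPath J → ℝ} {T : ℝ≥0} {K : ℝ}
    (h : ScalingBound ρ T K) (J₁ : Set J) (z : JumpPath J) {t : ℝ≥0} (ht : t ≤ T) :
    z.scaling ρ J₁ t ≤ K := by
  unfold scaling
  split_ifs with hτ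
  · refine h.le _ ?_ _ _ _
    have h1 : (z.exerciseTime J₁).toNNReal ≤ t :=
      ENNReal.toNNReal_mono ENNReal.coe_ne_top hτ
    exact h1.trans ht
  · exact h.one_le

variable [DiscreteTopology J]

theorem eventually_eq_right (z : JumpPath J) (t : ℝ≥0) : ∀ᶠ s in 𝓝[≥] t, z s = z t :=
  (z.2.1 t) ((isOpen_discrete {z t}).mem_nhds rfl)

theorem eventually_eq_left (z : JumpPath J) (t : ℝ≥0) : ∀ᶠ s in 𝓝[<] t, z s = z.left t :=
  (z.tendsto_left t) ((isOpen_discrete {z.left t}).mem_nhds rfl)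

theorem left_eq_of_eventually (z : JumpPath J) {t : ℝ≥0} (ht : 0 < t) {c : J}
    (h : ∀ᶠ s in 𝓝[<] t, z s = c) : z.left t = c := by
  have : (𝓝[<] t).NeBot := nhdsLT_neBot_of_exists_lt ⟨0, ht⟩
  obtain ⟨s, h1, h2⟩ := (h.and (z.eventually_eq_left t)).exists
  rw [← h1, h2]

theorem notMem_jumps_of_const (z : JumpPath J) {a b : ℝ≥0} {c : J}
    (h : ∀ s ∈ Set.Ioo a b, z s = c) {y : ℝ≥0} (hy : y ∈ Set.Ioo a b) : y ∉ z.jumps := by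
  rintro ⟨h0, hne⟩
  refine hne (Eq.trans (z.left_eq_of_eventually h0 ?_) (h y hy).symm)
  filter_upwards [Ioo_mem_nhdsLT hy.1] with s hs
  exact h s ⟨hs.1, hs.2.trans hy.2⟩

theorem eventually_notMem_jumps_right (z : JumpPath J) (x : ℝ≥0) :
    ∀ᶠ y in 𝓝[>] x, y ∉ z.jumps := by
  have h := (z.eventually_eq_right x).filter_mono (nhdsWithin_mono x Set.Ioi_subset_Ici_self)
  obtain ⟨b, hb, hsub⟩ := mem_nhdsGT_iff_exists_Ioo_subset.1 h
  filter_upwards [Ioo_mem_nhdsGT hb] with y hy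
  exact z.notMem_jumps_of_const hsub hy

theorem eventually_notMem_jumps_left (z : JumpPath J) (x : ℝ≥0) :
    ∀ᶠ y in 𝓝[<] x, y ∉ z.jumps := by
  rcases eq_or_ne x 0 with rfl | hx
  · simp
  obtain ⟨a, ha, hsub⟩ := (mem_nhdsLT_iff_exists_Ioo_subset' (pos_iff_ne_zero.2 hx)).1
    (z.eventually_eq_left x)
  filter_upwards [Ioo_mem_nhdsLT ha] with y hy
  exact z.notMem_jumps_of_const hsub hy

theorem finite_jumps_inter_Iic (z : JumpPath J) (T : ℝ≥0) : (z.jumps ∩ Set.Iic T).Finite := by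
  have h := (isCompact_Icc (a := (0 : ℝ≥0)) (b := T)).induction_on
    (p := fun s => (z.jumps ∩ s).Finite) (by simp)
    (fun s t hst ht => ht.subset (Set.inter_subset_inter_right _ hst))
    (fun s t hs ht => by rw [Set.inter_union_distrib_left]; exact hs.union ht)
    (fun x _ => by
      have h : ∀ᶠ y in 𝓝[≠] x, y ∉ z.jumps := by
        rw [← nhdsLT_sup_nhdsGT, eventually_sup]
        exact ⟨z.eventually_notMem_jumps_left x, z.eventually_notMem_jumps_right x⟩
      rw [eventually_nhdsWithin_iff] at h
      refine ⟨_, mem_nhdsWithin_of_mem_nhds h, (Set.finite_singleton x).subset ?_⟩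
      rintro y ⟨hy, hy'⟩
      by_contra hne
      exact hy' hne hy)
  exact h.subset fun x hx => ⟨hx.1, zero_le, hx.2⟩

/-- A path is continuous on an interval `[s, t]` without jumps in `(s, t]`, hence constant there. -/
theorem eq_of_no_jump (z : JumpPath J) {s t : ℝ≥0} (hst : s ≤ t)
    (h : ∀ x ∈ Set.Ioc s t, x ∉ z.jumps) : z s = z t := by
  have hc : ContinuousOn z (Set.Icc s t) := by
    intro x hx
    have hr : ContinuousWithinAt z (Set.Icc s t ∩ Set.Ici x) x :=
      (z.2.1 x).mono Set.inter_subset_right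
    have hl : ContinuousWithinAt z (Set.Icc s t ∩ Set.Iio x) x := by
      rcases hx.1.eq_or_lt with rfl | hsx
      · have : Set.Icc s t ∩ Set.Iio s = ∅ := by
          ext y; simp only [Set.mem_inter_iff, Set.mem_Icc, Set.mem_Iio, Set.mem_empty_iff_false,
            iff_false]
          exact fun hy => hy.1.1.not_gt hy.2
        rw [this]
        simp [ContinuousWithinAt]
      · have hx' := h x ⟨hsx, hx.2⟩
        have hxe : z.left x = z x := by
          by_contra hne
          exact hx' ⟨(zero_le).trans_lt hsx, hne⟩
        have := z.tendsto_left x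
        rw [hxe] at this
        have hcw : ContinuousWithinAt z (Set.Iio x) x := this
        exact hcw.mono Set.inter_subset_right
    have := hl.union hr
    rwa [← Set.inter_union_distrib_left, Set.Iio_union_Ici, Set.inter_univ] at this
  exact isPreconnected_Icc.constant hc (Set.left_mem_Icc.2 hst) (Set.right_mem_Icc.2 hst)

theorem finite_jumpTimes_inter (z : JumpPath J) {j k : J} (hjk : j ≠ k) {t : ℝ≥0} {B : Set ℝ≥0}
    (hB : B ⊆ Set.Iic t) : (z.jumpTimes j k ∩ B).Finite :=
  (z.finite_jumps_inter_Iic t).subset (Set.inter_subset_inter (z.jumpTimes_subset hjk) hB)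

section CountIntegral

variable (z : JumpPath J) {j k : J}

theorem countIntegral_eq_add (hjk : j ≠ k) (h : ℝ≥0 → ℝ) {s t : ℝ≥0} (hst : s ≤ t) :
    z.countIntegral j k h t =
      z.countIntegral j k h s + ∑ᶠ x ∈ z.jumpTimes j k ∩ Set.Ioc s t, h x := by
  unfold countIntegral
  rw [← Set.Iic_union_Ioc_eq_Iic hst, Set.inter_union_distrib_left]
  refine finsum_mem_union ?_ (z.finite_jumpTimes_inter hjk le_rfl)
    (z.finite_jumpTimes_inter hjk (t := t) fun x hx => hx.2)
  rw [Set.disjoint_left]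
  rintro x ⟨-, hx⟩ ⟨-, hx'⟩
  exact hx'.1.not_ge hx

theorem countIntegral_mono (hjk : j ≠ k) {h : ℝ≥0 → ℝ} (h0 : ∀ s, 0 ≤ h s) :
    Monotone (z.countIntegral j k h) := fun s t hst => by
  rw [z.countIntegral_eq_add hjk h hst]
  exact le_add_of_nonneg_right (finsum_nonneg fun x => finsum_nonneg fun _ => h0 x)

theorem count_eq_countIntegral (hjk : j ≠ k) (t : ℝ≥0) :
    (z.count j k t : ℝ) = z.countIntegral j k (fun _ => 1) t := by
  rw [countIntegral, finsum_mem_eq_finite_toFinset_sum _ (z.finite_jumpTimes_inter hjk le_rfl),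
    count, Set.ncard_eq_toFinset_card _ (z.finite_jumpTimes_inter hjk le_rfl)]
  simp

theorem countIntegral_sub_le (hjk : j ≠ k) {h : ℝ≥0 → ℝ} {K : ℝ} {s t : ℝ≥0} (hst : s ≤ t)
    (hK : ∀ x ∈ Set.Ioc s t, h x ≤ K) :
    z.countIntegral j k h t - z.countIntegral j k h s ≤ K * (z.count j k t - z.count j k s) := by
  have hfin := z.finite_jumpTimes_inter hjk (t := t) (B := Set.Ioc s t) fun x hx => hx.2
  rw [z.count_eq_countIntegral hjk, z.count_eq_countIntegral hjk,
    z.countIntegral_eq_add hjk h hst, z.countIntegral_eq_add hjk _ hst, add_sub_cancel_left,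
    add_sub_cancel_left, finsum_mem_eq_finite_toFinset_sum _ hfin,
    finsum_mem_eq_finite_toFinset_sum _ hfin, Finset.mul_sum]
  refine Finset.sum_le_sum fun x hx => ?_
  rw [mul_one]
  exact hK x ((Set.Finite.mem_toFinset _).1 hx).2

theorem count_mono (hjk : j ≠ k) : Monotone (z.count j k) := fun _ _ hst =>
  Set.ncard_le_ncard (Set.inter_subset_inter_right _ (Set.Iic_subset_Iic.2 hst))
    (z.finite_jumpTimes_inter hjk le_rfl)

theorem count_lt_of_jump (hjk : j ≠ k) {s t x : ℝ≥0} (hx : x ∈ Set.Ioc s t)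
    (hxj : x ∈ z.jumpTimes j k) : z.count j k s + 1 ≤ z.count j k t := by
  refine Set.ncard_lt_ncard (Set.ssubset_iff_of_subset (Set.inter_subset_inter_right _
    (Set.Iic_subset_Iic.2 (hx.1.le.trans hx.2))) |>.2 ⟨x, ⟨hxj, hx.2⟩, fun h => ?_⟩)
    (z.finite_jumpTimes_inter hjk le_rfl)
  exact hx.1.not_ge h.2

end CountIntegral

/-- The exercise time, unless it is zero or infinite, is a jump time. -/
theorem exists_jump_of_exerciseTime (J₁ : Set J) (z : JumpPath J) {s t : ℝ≥0}
    (h1 : (s : ℝ≥0∞) < z.exerciseTime J₁) (h2 : z.exerciseTime J₁ ≤ t) :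
    (z.exerciseTime J₁).toNNReal ∈ Set.Ioc s t ∧ (z.exerciseTime J₁).toNNReal ∈ z.jumps := by
  obtain ⟨x, hx⟩ := WithTop.ne_top_iff_exists.1 (h2.trans_lt ENNReal.coe_lt_top).ne
  change (x : ℝ≥0∞) = _ at hx
  rw [← hx] at h1 h2 ⊢
  rw [ENNReal.toNNReal_coe]
  have hsx : s < x := by exact_mod_cast h1
  have hx0 : 0 < x := (zero_le).trans_lt hsx
  refine ⟨⟨hsx, by exact_mod_cast h2⟩, hx0, ?_⟩
  have hbelow : ∀ y, 0 < y → y < x → z y ∉ J₁ := fun y hy hyx hyJ => by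
    have : z.exerciseTime J₁ ≤ y := iInf₂_le y ⟨hy, hyJ⟩
    rw [← hx] at this
    exact hyx.not_ge (by exact_mod_cast this)
  have hat : z x ∈ J₁ := by
    obtain ⟨b, hb, hsub⟩ := mem_nhdsGE_iff_exists_Ico_subset.1 (z.eventually_eq_right x)
    have hlt : z.exerciseTime J₁ < (b : ℝ≥0∞) := by rw [← hx]; exact_mod_cast hb
    simp only [exerciseTime, iInf_lt_iff] at hlt
    obtain ⟨y, ⟨hy0, hyJ⟩, hyb⟩ := hlt
    have hxy : x ≤ y := not_lt.1 fun h => hbelow y hy0 h hyJ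
    have : z y = z x := hsub ⟨hxy, by exact_mod_cast hyb⟩
    rwa [← this]
  have : (𝓝[<] x).NeBot := nhdsLT_neBot_of_exists_lt ⟨0, hx0⟩
  obtain ⟨y, hy1, hy2⟩ := ((z.eventually_eq_left x).and (Ioo_mem_nhdsLT hx0)).exists
  intro heq
  exact hbelow y hy2.1 hy2.2 (by rw [hy1, heq]; exact hat)

theorem scaling_eq_of_no_jump (ρ : ℝ≥0 → J → J → JumpPath J → ℝ) (J₁ : Set J) (z : JumpPath J)
    {s t : ℝ≥0} (hst : s ≤ t) (h : ∀ x ∈ Set.Ioc s t, x ∉ z.jumps) :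
    z.scaling ρ J₁ s = z.scaling ρ J₁ t := by
  unfold scaling
  have hiff : z.exerciseTime J₁ ≤ s ↔ z.exerciseTime J₁ ≤ t := by
    refine ⟨fun h' => h'.trans (by exact_mod_cast hst), fun h' => ?_⟩
    by_contra! hs
    obtain ⟨h1, h2⟩ := z.exists_jump_of_exerciseTime J₁ hs h'
    exact h _ h1 h2
  simp only [hiff]

/-- If `(s, t]` contains at most one jump, the sum of the scaling process over the jumps from `j` to
`k` in `(s, t]` can be read off from the end points, since the scaling process is constant
after the jump. -/
theorem sum_Ioc_scaling (ρ : ℝ≥0 → J → J → JumpPath J → ℝ) (J₁ : Set J) (z : JumpPath J)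
    {j k : J} (hjk : j ≠ k) {s t : ℝ≥0} (hst : s ≤ t) [Decidable (z s = j ∧ z t = k)]
    (hsub : (z.jumps ∩ Set.Ioc s t).Subsingleton) :
    ∑ᶠ x ∈ z.jumpTimes j k ∩ Set.Ioc s t, z.scaling ρ J₁ x =
      if z s = j ∧ z t = k then z.scaling ρ J₁ t else 0 := by
  have hss := Set.inter_subset_inter_left (Set.Ioc s t) (z.jumpTimes_subset hjk)
  rcases hsub.eq_empty_or_singleton with he | ⟨x, hx⟩
  · rw [he] at hss
    rw [Set.subset_empty_iff.1 hss, finsum_mem_empty, if_neg]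
    rintro ⟨h1, h2⟩
    refine hjk ?_
    rw [← h1, ← h2]
    refine z.eq_of_no_jump hst fun y hy hyj => ?_
    have : y ∈ z.jumps ∩ Set.Ioc s t := ⟨hyj, hy⟩
    rw [he] at this
    exact this
  · have hxm : x ∈ z.jumps ∩ Set.Ioc s t := by rw [hx]; rfl
    have honly : ∀ y ∈ Set.Ioc s t, y ∈ z.jumps → y = x := fun y hy hyj => by
      have : y ∈ z.jumps ∩ Set.Ioc s t := ⟨hyj, hy⟩
      rwa [hx] at this
    have hright : ∀ y ∈ Set.Ioc x t, y ∉ z.jumps := fun y hy hyj =>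
      hy.1.ne' (honly y ⟨hxm.2.1.trans hy.1, hy.2⟩ hyj)
    have hl : z.left x = z s := by
      refine z.left_eq_of_eventually hxm.1.1 ?_
      filter_upwards [Ioo_mem_nhdsLT hxm.2.1] with y hy
      exact (z.eq_of_no_jump hy.1.le fun w hw hwj => (hw.2.trans_lt hy.2).ne
        (honly w ⟨hw.1, hw.2.trans (hy.2.le.trans hxm.2.2)⟩ hwj)).symm
    have hr : z x = z t := z.eq_of_no_jump hxm.2.2 hright
    have hH : z.scaling ρ J₁ x = z.scaling ρ J₁ t := z.scaling_eq_of_no_jump ρ J₁ hxm.2.2 hright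
    split_ifs with hc
    · have : z.jumpTimes j k ∩ Set.Ioc s t = {x} := by
        refine (hss.trans hx.le).antisymm ?_
        rintro _ rfl
        exact ⟨⟨hxm.1.1, by rw [hl, hc.1], by rw [hr, hc.2]⟩, hxm.2⟩
      rw [this, finsum_mem_singleton, hH]
    · have : z.jumpTimes j k ∩ Set.Ioc s t = ∅ := by
        refine Set.eq_empty_of_forall_notMem fun y hy => hc ?_
        have hyx := hss hy
        rw [hx] at hyx
        obtain rfl : y = x := hyx
        exact ⟨by rw [← hl, hy.1.2.1], by rw [← hr, hy.1.2.2]⟩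
      rw [this, finsum_mem_empty]

theorem transitions_mono {ρ : ℝ≥0 → J → J → JumpPath J → ℝ} (hρ : ∀ t j k z, 0 ≤ ρ t j k z)
    (J₁ : Set J) {j k : J} (hjk : j ≠ k) (z : JumpPath J) (r : ℝ≥0) :
    Monotone fun t => z.transitions ρ J₁ j k t r := by
  refine z.countIntegral_mono hjk fun s => mul_nonneg (scaling_nonneg hρ J₁ z s) ?_
  split_ifs <;> norm_num

end Paths

section Control

variable {J : Type*} [TopologicalSpace J] [Fintype J]

/-- `K` times the number of events up to time `t`: the jumps of the path, and the censoring at time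
`r`.  It controls exposures and transitions if the scaling process is bounded by `K`. -/
noncomputable def eventBound (K : ℝ) (t : ℝ≥0) (z : JumpPath J) (r : ℝ≥0) : ℝ :=
  K * (∑ p ∈ (Finset.univ : Finset J).offDiag, (z.count p.1 p.2 t : ℝ) +
    (Set.Iic t).indicator 1 r)

theorem eventBound_nonneg {K : ℝ} (hK : 0 ≤ K) (t : ℝ≥0) (z : JumpPath J) (r : ℝ≥0) :
    0 ≤ eventBound K t z r := by
  unfold eventBound
  have h : (0 : ℝ) ≤ (Set.Iic t).indicator 1 r := Set.indicator_nonneg (fun _ _ => zero_le_one) r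
  positivity

theorem indicator_Iic_mono (r : ℝ≥0) {s t : ℝ≥0} (hst : s ≤ t) :
    (Set.Iic s).indicator (1 : ℝ≥0 → ℝ) r ≤ (Set.Iic t).indicator 1 r :=
  Set.indicator_le_indicator_of_subset (Set.Iic_subset_Iic.2 hst) (fun _ => zero_le_one) r

variable [DiscreteTopology J]

theorem count_mono_of_mem_offDiag (z : JumpPath J) {s t : ℝ≥0} (hst : s ≤ t) {p : J × J}
    (hp : p ∈ (Finset.univ : Finset J).offDiag) : (z.count p.1 p.2 s : ℝ) ≤ z.count p.1 p.2 t := by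
  exact_mod_cast z.count_mono (Finset.mem_offDiag.1 hp).2.2 hst

theorem isControl_eventBound {K : ℝ} (hK : 0 ≤ K) (z : JumpPath J) (r : ℝ≥0) :
    IsControl fun t => eventBound K t z r := by
  refine ⟨fun s t hst => ?_, fun t => ?_⟩
  · exact mul_le_mul_of_nonneg_left
      (add_le_add (Finset.sum_le_sum fun p hp => z.count_mono_of_mem_offDiag hst hp)
        (indicator_Iic_mono r hst)) hK
  · have h : ∀ᶠ s in 𝓝[≥] t, eventBound K s z r = eventBound K t z r := by
      obtain ⟨b, hb, hsub⟩ :=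
        mem_nhdsGT_iff_exists_Ioo_subset.1 (z.eventually_notMem_jumps_right t)
      have hr : ∀ᶠ s in 𝓝[≥] t, (r ≤ s ↔ r ≤ t) := by
        rcases le_or_gt r t with h | h
        · filter_upwards [self_mem_nhdsWithin] with s hs
          exact ⟨fun _ => h, fun _ => h.trans hs⟩
        · filter_upwards [nhdsWithin_le_nhds (Iio_mem_nhds h)] with s hs
          exact ⟨fun h' => absurd hs (not_lt.2 h'), fun h' => absurd h (not_lt.2 h')⟩
      filter_upwards [Ico_mem_nhdsGE hb, hr] with s hs hrs
      unfold eventBound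
      congr 2
      · refine Finset.sum_congr rfl fun p hp => ?_
        congr 1
        exact (z.count_eq_of_no_jump (Finset.mem_offDiag.1 hp).2.2 hs.1 fun x hx =>
          hsub ⟨hx.1, hx.2.trans_lt hs.2⟩).symm
      · simp only [Set.indicator, Set.mem_Iic, hrs]
    exact tendsto_const_nhds.congr' (h.mono fun s hs => hs.symm)

theorem le_eventBound_sub_of_jump {K : ℝ} (hK : 0 ≤ K) (z : JumpPath J) (r : ℝ≥0) {s t x : ℝ≥0}
    (hx : x ∈ Set.Ioc s t) (hxj : x ∈ z.jumps) :
    K ≤ eventBound K t z r - eventBound K s z r := by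
  classical
  have hst : s ≤ t := hx.1.le.trans hx.2
  have hmem : (z.left x, z x) ∈ (Finset.univ : Finset J).offDiag := by simpa using hxj.2
  have h1 : (z.count (z.left x) (z x) s : ℝ) + 1 ≤ z.count (z.left x) (z x) t := by
    exact_mod_cast z.count_lt_of_jump hxj.2 hx ⟨hxj.1, rfl, rfl⟩
  have h2 : ∑ p ∈ (Finset.univ : Finset J).offDiag, (z.count p.1 p.2 s : ℝ) + 1 ≤
      ∑ p ∈ (Finset.univ : Finset J).offDiag, (z.count p.1 p.2 t : ℝ) := by
    rw [← Finset.add_sum_erase _ _ hmem,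
      ← Finset.add_sum_erase _ (fun p : J × J => (z.count p.1 p.2 t : ℝ)) hmem]
    have := Finset.sum_le_sum (s := (Finset.univ : Finset J).offDiag.erase (z.left x, z x))
      fun p hp => z.count_mono_of_mem_offDiag hst (Finset.mem_of_mem_erase hp)
    simp only
    linarith
  have h3 := indicator_Iic_mono r hst
  rw [eventBound, eventBound, ← mul_sub]
  exact le_mul_of_one_le_right hK (by linarith)

theorem le_eventBound_sub_of_censoring {K : ℝ} (hK : 0 ≤ K) (z : JumpPath J) {r : ℝ≥0} {s t : ℝ≥0}
    (hr : r ∈ Set.Ioc s t) : K ≤ eventBound K t z r - eventBound K s z r := by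
  have h2 : ∑ p ∈ (Finset.univ : Finset J).offDiag, (z.count p.1 p.2 s : ℝ) ≤
      ∑ p ∈ (Finset.univ : Finset J).offDiag, (z.count p.1 p.2 t : ℝ) :=
    Finset.sum_le_sum fun p hp => z.count_mono_of_mem_offDiag (hr.1.le.trans hr.2) hp
  rw [eventBound, eventBound, ← mul_sub, Set.indicator_of_mem (Set.mem_Iic.2 hr.2),
    Set.indicator_of_notMem (mt Set.mem_Iic.1 (not_le.2 hr.1)), Pi.one_apply]
  exact le_mul_of_one_le_right hK (by linarith)

theorem exposure_controlledOn {ρ : ℝ≥0 → J → J → JumpPath J → ℝ} {T : ℝ≥0} {K : ℝ}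
    (hρ : ScalingBound ρ T K) (J₁ : Set J) (j : J) (z : JumpPath J) (r : ℝ≥0) :
    ControlledOn T (fun t => eventBound K t z r) (fun t => z.exposure ρ J₁ j t r) := by
  intro s t hst htT
  have hK : 0 ≤ K := zero_le_one.trans hρ.one_le
  have hb : ∀ s ≤ T, 0 ≤ z.exposure ρ J₁ j s r ∧ z.exposure ρ J₁ j s r ≤ K := fun s hs => by
    unfold exposure
    split_ifs
    · exact ⟨scaling_nonneg hρ.nonneg J₁ z s, hρ.scaling_le J₁ z hs⟩
    · exact ⟨le_rfl, hK⟩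
  by_cases hc : (∃ x ∈ Set.Ioc s t, x ∈ z.jumps) ∨ r ∈ Set.Ioc s t
  · have h1 : K ≤ eventBound K t z r - eventBound K s z r := by
      rcases hc with ⟨x, hx, hxj⟩ | hr
      · exact le_eventBound_sub_of_jump hK z r hx hxj
      · exact le_eventBound_sub_of_censoring hK z hr
    refine le_trans ?_ h1
    have h2 := hb s (hst.trans htT)
    have h3 := hb t htT
    rw [Real.norm_eq_abs, abs_le]
    constructor <;> linarith
  · -- without an event in `(s, t]`, the exposure does not change
    push Not at hc
    obtain ⟨hj, hr⟩ := hc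
    have hiff : s < r ↔ t < r := by
      refine ⟨fun h => ?_, hst.trans_lt⟩
      by_contra! h'
      exact hr ⟨h, h'⟩
    have : z.exposure ρ J₁ j s r = z.exposure ρ J₁ j t r := by
      unfold exposure
      rw [z.eq_of_no_jump hst hj, z.scaling_eq_of_no_jump ρ J₁ hst hj]
      by_cases h : z t = j ∧ t < r
      · rw [if_pos h, if_pos ⟨h.1, hiff.2 h.2⟩]
      · rw [if_neg h, if_neg fun h' => h ⟨h'.1, hiff.1 h'.2⟩]
    simp only [this]
    rw [sub_self, norm_zero]
    exact sub_nonneg.2 ((isControl_eventBound hK z r).mono hst)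

theorem transitions_controlledOn {ρ : ℝ≥0 → J → J → JumpPath J → ℝ} {T : ℝ≥0} {K : ℝ}
    (hρ : ScalingBound ρ T K) (J₁ : Set J) {j k : J} (hjk : j ≠ k) (z : JumpPath J) (r : ℝ≥0) :
    ControlledOn T (fun t => eventBound K t z r) (fun t => z.transitions ρ J₁ j k t r) := by
  intro s t hst htT
  have hK : 0 ≤ K := zero_le_one.trans hρ.one_le
  rw [Real.norm_eq_abs, abs_of_nonneg (sub_nonneg.2 (transitions_mono hρ.nonneg J₁ hjk z r hst))]
  refine (z.countIntegral_sub_le hjk hst (K := K) fun x hx => ?_).trans ?_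
  · have h1 := hρ.scaling_le J₁ z (hx.2.trans htT)
    split_ifs
    · rwa [mul_one]
    · rwa [mul_zero]
  · have hmem : (j, k) ∈ (Finset.univ : Finset J).offDiag := by simpa using hjk
    have h3 := indicator_Iic_mono r hst
    have h0 : ∀ p ∈ (Finset.univ : Finset J).offDiag,
        0 ≤ (z.count p.1 p.2 t : ℝ) - z.count p.1 p.2 s := fun p hp =>
      sub_nonneg.2 (z.count_mono_of_mem_offDiag hst hp)
    have h4 := Finset.single_le_sum h0 hmem
    rw [Finset.sum_sub_distrib] at h4
    simp only [eventBound]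
    rw [← mul_sub]
    refine mul_le_mul_of_nonneg_left ?_ hK
    linarith

end Control

end JumpPath

/-! ### Measurability on path space -/

namespace JumpPath

variable {J : Type*} [TopologicalSpace J] [DiscreteTopology J]

theorem exerciseTime_lt_iff (J₁ : Set J) (z : JumpPath J) (a : ℝ≥0∞) :
    z.exerciseTime J₁ < a ↔ ∃ n, 0 < TopologicalSpace.denseSeq ℝ≥0 n ∧
      (TopologicalSpace.denseSeq ℝ≥0 n : ℝ≥0∞) < a ∧ z (TopologicalSpace.denseSeq ℝ≥0 n) ∈ J₁ := by
  simp only [exerciseTime, iInf_lt_iff]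
  constructor
  · rintro ⟨t, ⟨ht0, htJ⟩, hta⟩
    obtain ⟨b, hb, hsub⟩ := mem_nhdsGE_iff_exists_Ico_subset.1 (z.eventually_eq_right t)
    obtain ⟨c, hc, hca⟩ : ∃ c : ℝ≥0, t < c ∧ (c : ℝ≥0∞) ≤ a := by
      obtain ⟨c, h1, h2⟩ := ENNReal.lt_iff_exists_nnreal_btwn.1 hta
      exact ⟨c, by exact_mod_cast h1, h2.le⟩
    obtain ⟨_, ⟨n, rfl⟩, h1, h2⟩ := (TopologicalSpace.denseRange_denseSeq ℝ≥0).exists_between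
      (lt_min hb hc)
    refine ⟨n, ht0.trans h1, ?_, ?_⟩
    · exact (ENNReal.coe_lt_coe.2 (h2.trans_le (min_le_right _ _))).trans_le hca
    · rwa [show z _ = z t from hsub ⟨h1.le, h2.trans_le (min_le_left _ _)⟩]
  · rintro ⟨n, h0, ha, hJ⟩
    exact ⟨_, ⟨h0, hJ⟩, ha⟩

/-- On a sufficiently fine grid, the integral of the scaling process against `N_{jk}` is *equal* to
a sum over the cells of the grid. -/
theorem countIntegral_eventually_eq (ρ : ℝ≥0 → J → J → JumpPath J → ℝ) (J₁ : Set J)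
    {j k : J} (hjk : j ≠ k) (z : JumpPath J) (t : ℝ≥0) :
    ∀ᶠ n in atTop, ∑ i ∈ Finset.range (n + 1),
      (Set.indicator {w : JumpPath J | w (uniformPartition t n i) = j ∧
        w (uniformPartition t n (i + 1)) = k}
        (fun w => w.scaling ρ J₁ (uniformPartition t n (i + 1))) z) =
      z.countIntegral j k (z.scaling ρ J₁) t := by
  classical
  obtain ⟨δ, hδ, hgap⟩ := exists_pos_gap (z.finite_jumps_inter_Iic t).toFinset
  filter_upwards [eventually_uniformPartition_mesh t hδ] with n hn
  have hcell : ∀ i ∈ Finset.range (n + 1),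
      Set.indicator {w : JumpPath J | w (uniformPartition t n i) = j ∧
        w (uniformPartition t n (i + 1)) = k}
        (fun w => w.scaling ρ J₁ (uniformPartition t n (i + 1))) z =
      z.countIntegral j k (z.scaling ρ J₁) (uniformPartition t n (i + 1)) -
        z.countIntegral j k (z.scaling ρ J₁) (uniformPartition t n i) := by
    intro i hi
    have hle := uniformPartition_mono t n i.le_succ
    have hend : uniformPartition t n (i + 1) ≤ t :=
      (uniformPartition_mono t n (Finset.mem_range.1 hi)).trans (uniformPartition_end t n).le
    rw [z.countIntegral_eq_add hjk _ hle, add_sub_cancel_left, z.sum_Ioc_scaling ρ J₁ hjk hle]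
    · simp only [Set.indicator, Set.mem_ofPred_eq]
    · have key : ∀ x ∈ z.jumps ∩ Set.Ioc (uniformPartition t n i) (uniformPartition t n (i + 1)),
          ∀ y ∈ z.jumps ∩ Set.Ioc (uniformPartition t n i) (uniformPartition t n (i + 1)),
          ¬ x < y := by
        intro x hx y hy hxy
        have h1 := hgap x ((Set.Finite.mem_toFinset _).2 ⟨hx.1, hx.2.2.trans hend⟩) y
          ((Set.Finite.mem_toFinset _).2 ⟨hy.1, hy.2.2.trans hend⟩) hxy
        exact (h1.trans (hy.2.2.trans (hn i).le)).not_gt (by gcongr; exact hx.2.1)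
      intro x hx y hy
      exact le_antisymm (not_lt.1 (key y hy x hx)) (not_lt.1 (key x hx y hy))
  rw [Finset.sum_congr rfl hcell, Finset.sum_range_sub
    (fun i => z.countIntegral j k (z.scaling ρ J₁) (uniformPartition t n i)),
    uniformPartition_end, uniformPartition_zero]
  have h0 : z.countIntegral j k (z.scaling ρ J₁) 0 = 0 := by
    have : z.jumpTimes j k ∩ Set.Iic 0 = ∅ :=
      Set.eq_empty_of_forall_notMem fun x hx => hx.1.1.not_ge hx.2
    rw [countIntegral, this, finsum_mem_empty]
  rw [h0, sub_zero]

variable [MeasurableSpace J] [DiscreteMeasurableSpace J]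

theorem borelSpace_of_discrete (J : Type*) [TopologicalSpace J] [DiscreteTopology J]
    [MeasurableSpace J] [DiscreteMeasurableSpace J] : BorelSpace J :=
  ⟨by rw [borel_eq_top_of_discrete]; exact eq_top_iff.2 fun _ _ => MeasurableSet.of_discrete⟩

theorem measurable_eval_uncurry : Measurable fun p : ℝ≥0 × JumpPath J => p.2 p.1 := by
  have := borelSpace_of_discrete J
  refine measurable_of_tendsto_metrizable
    (f := fun n (p : ℝ≥0 × JumpPath J) => p.2 (gridRight n p.1)) (fun n => ?_)
    (tendsto_pi_nhds.2 fun p => (p.2.2.1 p.1).tendsto.comp (tendsto_gridRight p.1))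
  have h : Measurable fun q : ℕ × JumpPath J => q.2 (((q.1 + 1 : ℕ) : ℝ≥0) / (n + 1)) :=
    measurable_from_prod_countable_right fun k =>
      measurable_eval (((k + 1 : ℕ) : ℝ≥0) / (n + 1))
  exact h.comp ((Nat.measurable_floor.comp (measurable_const.mul measurable_fst)).prodMk
    measurable_snd)

theorem measurable_left_uncurry : Measurable fun p : ℝ≥0 × JumpPath J => p.2.left p.1 := by
  have := borelSpace_of_discrete J
  refine measurable_of_tendsto_metrizable
    (f := fun n (p : ℝ≥0 × JumpPath J) => p.2 (gridLeft n p.1)) (fun n => ?_)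
    (tendsto_pi_nhds.2 fun ⟨t, z⟩ => ?_)
  · have h : Measurable fun q : ℕ × JumpPath J => q.2 (((q.1 - 1 : ℕ) : ℝ≥0) / (n + 1)) :=
      measurable_from_prod_countable_right fun k =>
        measurable_eval (((k - 1 : ℕ) : ℝ≥0) / (n + 1))
    exact h.comp ((Nat.measurable_ceil.comp (measurable_const.mul measurable_fst)).prodMk
      measurable_snd)
  · rcases eq_or_ne t 0 with rfl | ht
    · rw [left, leftLim_eq_of_isBot (fun _ => zero_le)]
      simp [gridLeft]
    · exact (z.tendsto_left t).comp (tendsto_gridLeft (pos_iff_ne_zero.2 ht))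

theorem measurable_exerciseTime (J₁ : Set J) :
    Measurable fun z : JumpPath J => z.exerciseTime J₁ := by
  refine measurable_of_Iio fun a => ?_
  have : (fun z : JumpPath J => z.exerciseTime J₁) ⁻¹' Set.Iio a =
      ⋃ n, {z | 0 < TopologicalSpace.denseSeq ℝ≥0 n ∧
      (TopologicalSpace.denseSeq ℝ≥0 n : ℝ≥0∞) < a ∧
      z (TopologicalSpace.denseSeq ℝ≥0 n) ∈ J₁} := by
    ext z
    simp [exerciseTime_lt_iff]
  rw [this]
  exact MeasurableSet.iUnion fun n => (MeasurableSet.const _).inter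
    ((MeasurableSet.const _).inter (measurable_eval _ MeasurableSet.of_discrete))

variable [Finite J]

theorem measurable_scaling_uncurry {ρ : ℝ≥0 → J → J → JumpPath J → ℝ}
    (hρ : ∀ j k, Measurable fun p : ℝ≥0 × JumpPath J => ρ p.1 j k p.2) (J₁ : Set J) :
    Measurable fun p : ℝ≥0 × JumpPath J => p.2.scaling ρ J₁ p.1 := by
  have hτ : Measurable fun z : JumpPath J => (z.exerciseTime J₁).toNNReal :=
    (measurable_exerciseTime J₁).ennreal_toNNReal
  have hτz : Measurable fun z : JumpPath J => ((z.exerciseTime J₁).toNNReal, z) :=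
    hτ.prodMk measurable_id
  have hl : Measurable fun z : JumpPath J => z.left (z.exerciseTime J₁).toNNReal :=
    measurable_left_uncurry.comp hτz
  have he : Measurable fun z : JumpPath J => z (z.exerciseTime J₁).toNNReal :=
    measurable_eval_uncurry.comp hτz
  have h1 : Measurable fun q : (J × J) × JumpPath J =>
      ρ (q.2.exerciseTime J₁).toNNReal q.1.1 q.1.2 q.2 :=
    measurable_from_prod_countable_right fun jk => (hρ jk.1 jk.2).comp hτz
  have h2 : Measurable fun z : JumpPath J => ((z.left (z.exerciseTime J₁).toNNReal,
      z (z.exerciseTime J₁).toNNReal), z) := (hl.prodMk he).prodMk measurable_id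
  have h3 := h1.comp h2
  have hs : MeasurableSet {p : ℝ≥0 × JumpPath J | p.2.exerciseTime J₁ ≤ (p.1 : ℝ≥0∞)} :=
    measurableSet_le ((measurable_exerciseTime J₁).comp measurable_snd)
      measurable_fst.coe_nnreal_ennreal
  have hsnd : Measurable fun p : ℝ≥0 × JumpPath J => p.2 := measurable_snd
  have h4 := h3.comp hsnd
  simp only [Function.comp_def] at h4
  unfold scaling
  exact Measurable.ite hs h4 measurable_const

theorem measurable_countIntegral_uncurry {ρ : ℝ≥0 → J → J → JumpPath J → ℝ}
    (hρ : ∀ j k, Measurable fun p : ℝ≥0 × JumpPath J => ρ p.1 j k p.2) (J₁ : Set J)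
    {j k : J} (hjk : j ≠ k) :
    Measurable fun p : ℝ≥0 × JumpPath J => p.2.countIntegral j k (p.2.scaling ρ J₁) p.1 := by
  refine measurable_of_tendsto_metrizable
    (f := fun n (p : ℝ≥0 × JumpPath J) => ∑ i ∈ Finset.range (n + 1),
      (Set.indicator {w : JumpPath J | w (uniformPartition p.1 n i) = j ∧
        w (uniformPartition p.1 n (i + 1)) = k}
        (fun w => w.scaling ρ J₁ (uniformPartition p.1 n (i + 1))) p.2)) (fun n => ?_)
    (tendsto_pi_nhds.2 fun p => tendsto_const_nhds.congr'
      ((countIntegral_eventually_eq ρ J₁ hjk p.2 p.1).mono fun n hn => hn.symm))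
  refine Finset.measurable_sum _ fun i _ => ?_
  have hu : ∀ i, Measurable fun p : ℝ≥0 × JumpPath J => (uniformPartition p.1 n i, p.2) :=
    fun i => ((measurable_fst.mul measurable_const).div measurable_const).prodMk measurable_snd
  exact ((measurable_scaling_uncurry hρ J₁).comp (hu (i + 1))).indicator
    (s := {p : ℝ≥0 × JumpPath J | p.2 (uniformPartition p.1 n i) = j ∧
      p.2 (uniformPartition p.1 n (i + 1)) = k})
    (((measurable_eval_uncurry.comp (hu i)) (measurableSet_singleton j)).inter
      ((measurable_eval_uncurry.comp (hu (i + 1))) (measurableSet_singleton k)))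

theorem measurable_transitions {ρ : ℝ≥0 → J → J → JumpPath J → ℝ}
    (hρ : ∀ j k, Measurable fun p : ℝ≥0 × JumpPath J => ρ p.1 j k p.2) (J₁ : Set J)
    {j k : J} (hjk : j ≠ k) (t : ℝ≥0) :
    Measurable fun p : JumpPath J × ℝ≥0 => p.1.transitions ρ J₁ j k t p.2 := by
  simp only [transitions_eq_countIntegral]
  have h : Measurable fun p : JumpPath J × ℝ≥0 => (min t p.2, p.1) :=
    (measurable_const.min measurable_snd).prodMk measurable_fst
  have h' := (measurable_countIntegral_uncurry hρ J₁ hjk).comp h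
  simp only [Function.comp_def] at h'
  exact h'

theorem measurable_exposure {ρ : ℝ≥0 → J → J → JumpPath J → ℝ}
    (hρ : ∀ j k, Measurable fun p : ℝ≥0 × JumpPath J => ρ p.1 j k p.2) (J₁ : Set J)
    (j : J) (t : ℝ≥0) :
    Measurable fun p : JumpPath J × ℝ≥0 => p.1.exposure ρ J₁ j t p.2 := by
  have hs : MeasurableSet ({p : JumpPath J × ℝ≥0 | p.1 t = j} ∩ {p | t < p.2}) :=
    ((measurable_eval t).comp measurable_fst (measurableSet_singleton j)).inter
      (measurableSet_lt measurable_const measurable_snd)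
  have h : Measurable fun p : JumpPath J × ℝ≥0 => (t, p.1) := measurable_const.prodMk measurable_fst
  have h' := (measurable_scaling_uncurry hρ J₁).comp h
  simp only [Function.comp_def] at h'
  unfold exposure
  exact Measurable.ite hs h' measurable_const

/-- The counting process is the integral of the unscaled scaling process, which is one. -/
theorem measurable_count {j k : J} (hjk : j ≠ k) (t : ℝ≥0) :
    Measurable fun z : JumpPath J => (z.count j k t : ℝ) := by
  have h := (measurable_countIntegral_uncurry (ρ := unscaled) (J := J)
    (fun _ _ => measurable_const) ∅ hjk).comp (measurable_const (a := t) |>.prodMk measurable_id)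
  convert h using 2 with z
  rw [z.count_eq_countIntegral hjk]
  simp only [Function.comp, id]
  congr 1
  ext s
  simp [scaling, unscaled]

theorem measurable_eventBound {J : Type*} [TopologicalSpace J] [DiscreteTopology J]
    [MeasurableSpace J] [DiscreteMeasurableSpace J] [Fintype J] (K : ℝ) (t : ℝ≥0) :
    Measurable fun p : JumpPath J × ℝ≥0 => eventBound K t p.1 p.2 := by
  unfold eventBound
  refine measurable_const.mul ((Finset.measurable_sum _ fun q hq => ?_).add ?_)
  · exact (measurable_count (Finset.mem_offDiag.1 hq).2.2 t).comp measurable_fst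
  · exact (measurable_one.indicator measurableSet_Iic).comp measurable_snd

end JumpPath

/-! ### A uniform strong law of large numbers -/

section GlivenkoCantelli

variable {Ω : Type*} [MeasurableSpace Ω] {P : Measure Ω}

/-- The mean of an integrable control is a control. -/
theorem isControl_integral {V : ℝ≥0 → Ω → ℝ}
    (hc : ∀ ω, IsControl fun t => V t ω) (h0 : ∀ t ω, 0 ≤ V t ω)
    (hint : ∀ t, Integrable (V t) P) : IsControl fun t => ∫ ω, V t ω ∂P := by
  refine ⟨fun s t hst => integral_mono (hint s) (hint t) fun ω => (hc ω).mono hst, fun t => ?_⟩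
  refine tendsto_integral_filter_of_dominated_convergence (V (t + 1)) ?_ ?_ (hint _) ?_
  · exact Eventually.of_forall fun s => (hint s).aestronglyMeasurable
  · filter_upwards [nhdsWithin_le_nhds (Iio_mem_nhds (lt_add_one t))] with s hs
    refine Eventually.of_forall fun ω => ?_
    rw [Real.norm_eq_abs, abs_of_nonneg (h0 s ω)]
    exact (hc ω).mono (le_of_lt hs)
  · exact Eventually.of_forall fun ω => (hc ω).rightCont t

theorem integrable_of_controlledOn {V Y : ℝ≥0 → Ω → ℝ} {T : ℝ≥0}
    (hint : ∀ t, Integrable (V t) P) (hY : ∀ t, Measurable (Y t))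
    (hYV : ∀ ω, ControlledOn T (fun t => V t ω) (fun t => Y t ω)) (hY0 : Integrable (Y 0) P)
    {t : ℝ≥0} (ht : t ≤ T) : Integrable (Y t) P := by
  have h : Integrable (fun ω => Y t ω - Y 0 ω) P :=
    ((hint t).sub (hint 0)).mono' ((hY t).sub (hY 0)).aestronglyMeasurable
      (Eventually.of_forall fun ω => hYV ω 0 t zero_le ht)
  refine (h.add hY0).congr (Eventually.of_forall fun ω => ?_)
  simp

theorem controlledOn_integral {V Y : ℝ≥0 → Ω → ℝ} {T : ℝ≥0}
    (hint : ∀ t, Integrable (V t) P) (hYint : ∀ t ≤ T, Integrable (Y t) P)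
    (hYV : ∀ ω, ControlledOn T (fun t => V t ω) (fun t => Y t ω)) :
    ControlledOn T (fun t => ∫ ω, V t ω ∂P) (fun t => ∫ ω, Y t ω ∂P) := by
  intro s t hst htT
  rw [← integral_sub (hYint t htT) (hYint s (hst.trans htT)), ← integral_sub (hint t) (hint s)]
  exact norm_integral_le_of_norm_le ((hint t).sub (hint s))
    (Eventually.of_forall fun ω => hYV ω s t hst htT)

/-- The average of the first `n` terms (zero if `n = 0`). -/
noncomputable def avg (n : ℕ) (x : ℕ → ℝ) : ℝ := 1 / (n : ℝ) * ∑ l ∈ Finset.range n, x l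

theorem avg_mono {n : ℕ} {x y : ℕ → ℝ} (h : ∀ l, x l ≤ y l) : avg n x ≤ avg n y := by
  unfold avg
  have := Finset.sum_le_sum (s := Finset.range n) fun l _ => h l
  gcongr

theorem avg_sub (n : ℕ) (x y : ℕ → ℝ) : avg n x - avg n y = avg n fun l => x l - y l := by
  simp only [avg, Finset.sum_sub_distrib, mul_sub]

theorem isControl_avg (n : ℕ) {V : ℕ → ℝ≥0 → ℝ} (h : ∀ l, IsControl (V l)) :
    IsControl fun t => avg n fun l => V l t := by
  refine ⟨fun s t hst => avg_mono fun l => (h l).mono hst, fun t => ?_⟩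
  unfold avg
  exact ContinuousWithinAt.mul continuousWithinAt_const
    (tendsto_finsetSum _ fun l _ => (h l).rightCont t)

theorem controlledOn_avg (n : ℕ) {T : ℝ≥0} {V Y : ℕ → ℝ≥0 → ℝ}
    (h : ∀ l, ControlledOn T (V l) (Y l)) :
    ControlledOn T (fun t => avg n fun l => V l t) (fun t => avg n fun l => Y l t) := by
  intro s t hst htT
  have h1 := fun l => abs_le.1 (h l s t hst htT)
  rw [avg_sub, avg_sub, Real.norm_eq_abs, abs_le]
  constructor
  · have : -avg n (fun l => V l t - V l s) = avg n fun l => -(V l t - V l s) := by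
      simp only [avg, Finset.sum_neg_distrib, mul_neg]
    rw [this]
    exact avg_mono fun l => (h1 l).1
  · exact avg_mono fun l => (h1 l).2

theorem avg_tendsto_integral {S : Type*} [MeasurableSpace S] [IsProbabilityMeasure P]
    {ξ : ℕ → Ω → S} {ξ₀ : Ω → S}
    (hindep : iIndepFun ξ P) (hident : ∀ l, IdentDistrib (ξ l) ξ₀ P P) {f : S → ℝ}
    (hf : Measurable f) (hint : Integrable (fun ω => f (ξ₀ ω)) P) :
    ∀ᵐ ω ∂P, Tendsto (fun n => avg n fun l => f (ξ l ω)) atTop (𝓝 (∫ ω, f (ξ₀ ω) ∂P)) := by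
  have hid : ∀ l, IdentDistrib (fun ω => f (ξ l ω)) (fun ω => f (ξ₀ ω)) P P :=
    fun l => (hident l).comp hf
  have h := strong_law_ae_real (fun l ω => f (ξ l ω)) ((hid 0).integrable_iff.2 hint)
    (fun i j hij => (hindep.indepFun hij).comp hf hf) (fun l => (hid l).trans (hid 0).symm)
  have he := (hid 0).integral_eq
  filter_upwards [h] with ω hω
  rw [he] at hω
  refine hω.congr fun n => ?_
  rw [avg, div_eq_inv_mul, one_div]

/-- A Glivenko–Cantelli theorem for processes `Y` whose increments are bounded by those of an
integrable monotone process `V`.  The process is squeezed between consecutive points of a finite set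
with the help of the strong law for `V` at the left point and for its left limit at the right
point. -/
theorem tendstoUniformlyOn_avg {S : Type*} [MeasurableSpace S] [IsProbabilityMeasure P]
    {ξ : ℕ → Ω → S} {ξ₀ : Ω → S}
    (hindep : iIndepFun ξ P) (hident : ∀ l, IdentDistrib (ξ l) ξ₀ P P) (hξ₀ : Measurable ξ₀)
    {V Y : ℝ≥0 → S → ℝ} (hV : ∀ t, Measurable (V t)) (hY : ∀ t, Measurable (Y t))
    (hc : ∀ x, IsControl fun t => V t x) (h0 : ∀ t x, 0 ≤ V t x)
    (hint : ∀ t, Integrable (fun ω => V t (ξ₀ ω)) P) {T : ℝ≥0}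
    (hYV : ∀ x, ControlledOn T (fun t => V t x) (fun t => Y t x))
    (hY0 : Integrable (fun ω => Y 0 (ξ₀ ω)) P) :
    ∀ᵐ ω ∂P, TendstoUniformlyOn (fun n t => avg n fun l => Y t (ξ l ω))
      (fun t => ∫ ω, Y t (ξ₀ ω) ∂P) atTop (Set.Icc 0 T) := by
  classical
  set v : ℝ≥0 → ℝ := fun t => ∫ ω, V t (ξ₀ ω) ∂P with hvdef
  have hvc : IsControl v := isControl_integral (fun ω => hc (ξ₀ ω)) (fun t ω => h0 t _) hint
  have hYint : ∀ t ≤ T, Integrable (fun ω => Y t (ξ₀ ω)) P := fun t ht =>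
    integrable_of_controlledOn (V := fun t ω => V t (ξ₀ ω)) (Y := fun t ω => Y t (ξ₀ ω)) hint
      (fun t => (hY t).comp hξ₀) (fun ω => hYV (ξ₀ ω)) hY0 ht
  have hYv : ControlledOn T v (fun t => ∫ ω, Y t (ξ₀ ω) ∂P) :=
    controlledOn_integral (V := fun t ω => V t (ξ₀ ω)) (Y := fun t ω => Y t (ξ₀ ω)) hint hYint
      (fun ω => hYV (ξ₀ ω))
  -- the left limits of the control processes are random variables
  have hVl : ∀ b : ℝ≥0, 0 < b → Measurable fun x => Function.leftLim (fun t => V t x) b := by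
    intro b hb
    refine measurable_of_tendsto_metrizable (f := fun n x => V (gridLeft n b) x) (fun n => hV _)
      (tendsto_pi_nhds.2 fun x => ?_)
    exact ((hc x).mono.tendsto_leftLim b).comp (tendsto_gridLeft hb)
  have hVlb : ∀ b x, 0 ≤ Function.leftLim (fun t => V t x) b ∧
      Function.leftLim (fun t => V t x) b ≤ V b x := fun b x => by
    refine ⟨?_, (hc x).mono.leftLim_le le_rfl⟩
    rcases eq_or_ne b 0 with rfl | hb
    · rw [leftLim_eq_of_isBot (fun _ => zero_le)]
      exact h0 _ _
    · exact (h0 0 x).trans ((hc x).mono.le_leftLim (pos_iff_ne_zero.2 hb))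
  have hVlint : ∀ b : ℝ≥0, 0 < b →
      Integrable (fun ω => Function.leftLim (fun t => V t (ξ₀ ω)) b) P := by
    intro b hb
    refine (hint b).mono' ((hVl b hb).comp hξ₀).aestronglyMeasurable
      (Eventually.of_forall fun ω => ?_)
    rw [Real.norm_eq_abs, abs_of_nonneg (hVlb b _).1]
    exact (hVlb b _).2
  have hvl : ∀ b : ℝ≥0, 0 < b →
      ∫ ω, Function.leftLim (fun t => V t (ξ₀ ω)) b ∂P = Function.leftLim v b := by
    intro b hb
    refine tendsto_nhds_unique ?_ ((hvc.mono.tendsto_leftLim b).comp (tendsto_gridLeft hb))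
    refine tendsto_integral_of_dominated_convergence (fun ω => V b (ξ₀ ω))
      (fun n => (hint _).aestronglyMeasurable) (hint b)
      (fun n => Eventually.of_forall fun ω => ?_) (Eventually.of_forall fun ω =>
        ((hc (ξ₀ ω)).mono.tendsto_leftLim b).comp (tendsto_gridLeft hb))
    rw [Real.norm_eq_abs, abs_of_nonneg (h0 _ _)]
    exact (hc _).mono (gridLeft_lt n hb).le
  -- finite sets of separating points for the tolerances `1 / (p + 1)`
  choose X hX using fun p : ℕ =>
    hvc.exists_finset T (η := 1 / ((p : ℝ) + 1)) Nat.one_div_pos_of_nat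
  set G : ℕ → Finset ℝ≥0 := fun p => insert 0 (insert T ((X p).filter (· ≤ T))) with hG
  have hGT : ∀ p, ∀ x ∈ G p, x ≤ T := by
    intro p x hx
    simp only [hG, Finset.mem_insert, Finset.mem_filter] at hx
    rcases hx with rfl | rfl | hx
    exacts [zero_le, le_rfl, hx.2]
  have hae : ∀ᵐ ω ∂P, ∀ p, ∀ x ∈ G p,
      Tendsto (fun n => avg n fun l => Y x (ξ l ω)) atTop (𝓝 (∫ ω, Y x (ξ₀ ω) ∂P)) ∧
      Tendsto (fun n => avg n fun l => V x (ξ l ω)) atTop (𝓝 (v x)) ∧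
      (0 < x → Tendsto (fun n => avg n fun l => Function.leftLim (fun t => V t (ξ l ω)) x) atTop
        (𝓝 (Function.leftLim v x))) := by
    refine ae_all_iff.2 fun p => (Finset.eventually_all (G p)).2 fun x hx => ?_
    have h1 := avg_tendsto_integral hindep hident (hY x) (hYint x (hGT p x hx))
    have h2 := avg_tendsto_integral hindep hident (hV x) (hint x)
    rcases eq_or_ne x 0 with hx0 | hx0
    · filter_upwards [h1, h2] with ω h1 h2
      exact ⟨h1, h2, fun h => absurd hx0 h.ne'⟩
    · have hx0 := pos_iff_ne_zero.2 hx0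
      have h3 := avg_tendsto_integral hindep hident (hVl x hx0) (hVlint x hx0)
      rw [hvl x hx0] at h3
      filter_upwards [h1, h2, h3] with ω h1 h2 h3
      exact ⟨h1, h2, fun _ => h3⟩
  filter_upwards [hae] with ω hω
  rw [Metric.tendstoUniformlyOn_iff]
  intro e he
  obtain ⟨p, hp⟩ := exists_nat_one_div_lt (show 0 < e / 5 by positivity)
  set η := 1 / ((p : ℝ) + 1) with hη
  have hη0 : 0 < η := Nat.one_div_pos_of_nat
  have hev : ∀ᶠ n in atTop, ∀ x ∈ G p,
      |(avg n fun l => Y x (ξ l ω)) - ∫ ω, Y x (ξ₀ ω) ∂P| < η ∧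
      |(avg n fun l => V x (ξ l ω)) - v x| < η ∧
      (0 < x → |(avg n fun l => Function.leftLim (fun t => V t (ξ l ω)) x) -
        Function.leftLim v x| < η) := by
    refine (Finset.eventually_all (G p)).2 fun x hx => ?_
    obtain ⟨h1, h2, h3⟩ := hω p x hx
    have h1' := h1.eventually (Metric.ball_mem_nhds _ hη0)
    have h2' := h2.eventually (Metric.ball_mem_nhds _ hη0)
    rcases eq_or_ne x 0 with hx0 | hx0
    · filter_upwards [h1', h2'] with n h1 h2
      exact ⟨h1, h2, fun h => absurd hx0 h.ne'⟩
    · filter_upwards [h1', h2', (h3 (pos_iff_ne_zero.2 hx0)).eventually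
        (Metric.ball_mem_nhds _ hη0)] with n h1 h2 h3
      exact ⟨h1, h2, fun _ => h3⟩
  filter_upwards [hev] with n hn t ht
  rw [dist_comm, Real.dist_eq]
  by_cases htG : t ∈ G p
  · have := (hn t htG).1
    linarith
  have hAne : ((G p).filter (· < t)).Nonempty := by
    refine ⟨0, Finset.mem_filter.2 ⟨by simp [hG], pos_iff_ne_zero.2 fun h => htG ?_⟩⟩
    rw [h]; simp [hG]
  have hBne : ((G p).filter (t < ·)).Nonempty := by
    refine ⟨T, Finset.mem_filter.2 ⟨by simp [hG], lt_of_le_of_ne ht.2 fun h => htG ?_⟩⟩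
    rw [h]; simp [hG]
  set a := ((G p).filter (· < t)).max' hAne with ha
  set b := ((G p).filter (t < ·)).min' hBne with hb
  obtain ⟨haG, hat⟩ := Finset.mem_filter.1 (((G p).filter (· < t)).max'_mem hAne)
  obtain ⟨hbG, htb⟩ := Finset.mem_filter.1 (((G p).filter (t < ·)).min'_mem hBne)
  rw [← ha] at haG hat
  rw [← hb] at hbG htb
  have hgap : ∀ x ∈ G p, a < x → b ≤ x := by
    intro x hx hax
    rcases lt_trichotomy x t with h | h | h
    · exact absurd hax (not_lt.2 (Finset.le_max' _ _ (Finset.mem_filter.2 ⟨hx, h⟩)))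
    · exact absurd (h ▸ hx) htG
    · exact Finset.min'_le _ _ (Finset.mem_filter.2 ⟨hx, h⟩)
  have hb0 : 0 < b := (zero_le).trans_lt htb
  have hbT := hGT p b hbG
  have hsmall : ∀ s, a ≤ s → s < b → v s - v a ≤ η := by
    intro s has hsb
    refine (hX p a s has (hsb.le.trans hbT) fun x hx hax => ?_).le
    rcases le_or_gt x T with h | h
    · exact hsb.trans_le (hgap x (by simp [hG, hx, h]) hax)
    · exact (hsb.le.trans hbT).trans_lt h
  have hleft : Function.leftLim v b - v a ≤ η := by
    have : (𝓝[<] b).NeBot := nhdsLT_neBot_of_exists_lt ⟨0, hb0⟩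
    refine le_of_tendsto ((hvc.mono.tendsto_leftLim b).sub_const (v a)) ?_
    filter_upwards [Ioo_mem_nhdsLT (hat.trans htb)] with s hs
    exact hsmall s hs.1.le hs.2
  obtain ⟨e1, e2, -⟩ := hn a haG
  obtain ⟨-, -, e3⟩ := hn b hbG
  have e3 := e3 hb0
  have e4 : |(avg n fun l => Y t (ξ l ω)) - avg n fun l => Y a (ξ l ω)| ≤
      (avg n fun l => V t (ξ l ω)) - avg n fun l => V a (ξ l ω) :=
    controlledOn_avg n (fun l => hYV (ξ l ω)) a t hat.le ht.2
  have e5 : (avg n fun l => V t (ξ l ω)) ≤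
      avg n fun l => Function.leftLim (fun t => V t (ξ l ω)) b :=
    avg_mono fun l => (hc (ξ l ω)).mono.le_leftLim htb
  have e6 : |(∫ ω, Y t (ξ₀ ω) ∂P) - ∫ ω, Y a (ξ₀ ω) ∂P| ≤ v t - v a := hYv a t hat.le ht.2
  have e7 := hsmall t hat.le htb
  rw [abs_lt] at e1 e2 e3
  rw [abs_le] at e4 e6
  rw [abs_lt]
  constructor <;> linarith

end GlivenkoCantelli

/-! ### Consistency of the estimators -/

theorem predictable_le_prod {Ω : Type*} {m : MeasurableSpace Ω} (𝓕 : Filtration ℝ≥0 m) :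
    𝓕.predictable ≤ (Prod.instMeasurableSpace : MeasurableSpace (ℝ≥0 × Ω)) :=
  measurableSpace_le_predictable_of_measurableSet
    (fun A hA => (measurableSet_singleton _).prod (𝓕.le _ A hA))
    (fun i A hA => measurableSet_Ioi.prod (𝓕.le i A hA))

open JumpPath

/-- The scaling factors are jointly measurable, non-negative, and bounded on compacts. -/
structure IsScalingFactor {J : Type*} [TopologicalSpace J] [MeasurableSpace J]
    (ρ : ℝ≥0 → J → J → JumpPath J → ℝ) : Prop where
  measurable : ∀ j k, Measurable fun p : ℝ≥0 × JumpPath J => ρ p.1 j k p.2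
  nonneg : ∀ t j k z, 0 ≤ ρ t j k z
  bdd : ∀ T : ℝ≥0, ∃ C : ℝ, ∀ t ≤ T, ∀ j k z, ρ t j k z ≤ C

theorem isScalingFactor_unscaled {J : Type*} [TopologicalSpace J] [MeasurableSpace J] :
    IsScalingFactor (unscaled (J := J)) :=
  ⟨fun _ _ => measurable_const, fun _ _ _ _ => zero_le_one, fun _ => ⟨1, fun _ _ _ _ _ => le_rfl⟩⟩

theorem IsScalingFactor.exists_bound {J : Type*} [TopologicalSpace J] [MeasurableSpace J]
    {ρ : ℝ≥0 → J → J → JumpPath J → ℝ} (hρ : IsScalingFactor ρ) (T : ℝ≥0) :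
    ∃ K, ScalingBound ρ T K ∧ ScalingBound (unscaled (J := J)) T K := by
  obtain ⟨C, hC⟩ := hρ.bdd T
  exact ⟨max 1 C, ⟨le_max_left _ _, hρ.nonneg, fun t ht j k z => (hC t ht j k z).trans
    (le_max_right _ _)⟩, ⟨le_max_left _ _, fun _ _ _ _ => zero_le_one,
      fun _ _ _ _ _ => le_max_left _ _⟩⟩

section Estimators

variable {J : Type*} [TopologicalSpace J] [DiscreteTopology J] [Fintype J] [MeasurableSpace J]
  {Ω : Type*} {Zs : ℕ → Ω → JumpPath J} {Rs : ℕ → Ω → ℝ≥0} {J₁ : Set J}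
  {ρ : ℝ≥0 → J → J → JumpPath J → ℝ}

theorem locallyControlled_avg_exposure (hρ : IsScalingFactor ρ) (n : ℕ) (ω : Ω) (j : J) :
    LocallyControlled fun t => avg n fun l => (Zs l ω).exposure ρ J₁ j t (Rs l ω) := fun T =>
  let ⟨_, hK, _⟩ := hρ.exists_bound T
  ⟨_, isControl_avg n fun l => isControl_eventBound (zero_le_one.trans hK.one_le) (Zs l ω) (Rs l ω),
    controlledOn_avg n fun l => exposure_controlledOn hK J₁ j (Zs l ω) (Rs l ω)⟩

theorem isControl_avg_transitions (hρ : IsScalingFactor ρ) (n : ℕ) (ω : Ω) {j k : J}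
    (hjk : j ≠ k) :
    IsControl fun t => avg n fun l => (Zs l ω).transitions ρ J₁ j k t (Rs l ω) :=
  LocallyControlled.isControl (fun T =>
    let ⟨_, hK, _⟩ := hρ.exists_bound T
    ⟨_, isControl_avg n fun l =>
      isControl_eventBound (zero_le_one.trans hK.one_le) (Zs l ω) (Rs l ω),
      controlledOn_avg n fun l => transitions_controlledOn hK J₁ hjk (Zs l ω) (Rs l ω)⟩)
    fun _ _ hst => avg_mono fun l => transitions_mono hρ.nonneg J₁ hjk (Zs l ω) (Rs l ω) hst

theorem nelsonAalenEntry_controlledOn (hρ : IsScalingFactor ρ) {ε : ℝ} (hε : 0 < ε) {T : ℝ≥0}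
    {K : ℝ} (hK : ScalingBound ρ T K) (n : ℕ) (ω : Ω) {j k : J} (hjk : j ≠ k) :
    ControlledOn T (fun t => 1 / ε * avg n fun l => eventBound K t (Zs l ω) (Rs l ω))
      (nelsonAalenEntry Zs Rs J₁ ε ρ n ω j k) :=
  perturbedHazard_controlledOn hε (locallyControlled_avg_exposure hρ n ω j).exists_tendsto_left
    (isControl_avg_transitions hρ n ω hjk)
    (controlledOn_avg n fun l => transitions_controlledOn hK J₁ hjk (Zs l ω) (Rs l ω))

end Estimators

section Targets

variable {J : Type*} [TopologicalSpace J] {Ω : Type*} [MeasurableSpace Ω] {P : Measure Ω}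
  {Z : Ω → JumpPath J} {R : Ω → ℝ≥0} {J₁ : Set J} {ρ : ℝ≥0 → J → J → JumpPath J → ℝ}

theorem integrable_transitions_zero (j k : J) :
    Integrable (fun ω => (Z ω).transitions ρ J₁ j k 0 (R ω)) P := by
  simp [transitions_zero]

variable [IsProbabilityMeasure P] [Fintype J]

theorem integrable_eventBound (hR : Measurable R)
    (hN : ∀ j k : J, j ≠ k → ∀ t : ℝ≥0, Integrable (fun ω => ((Z ω).count j k t : ℝ)) P) (K : ℝ)
    (t : ℝ≥0) : Integrable (fun ω => eventBound K t (Z ω) (R ω)) P := by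
  unfold eventBound
  refine Integrable.const_mul (Integrable.add (integrable_finsetSum _ fun p hp =>
    hN p.1 p.2 (Finset.mem_offDiag.1 hp).2.2 t) ?_) K
  exact (integrable_const (1 : ℝ)).indicator (hR measurableSet_Iic)

variable [DiscreteTopology J]

theorem isControl_integral_eventBound (hR : Measurable R)
    (hN : ∀ j k : J, j ≠ k → ∀ t : ℝ≥0, Integrable (fun ω => ((Z ω).count j k t : ℝ)) P) {K : ℝ}
    (hK : 0 ≤ K) : IsControl fun t => ∫ ω, eventBound K t (Z ω) (R ω) ∂P :=
  isControl_integral (fun ω => isControl_eventBound hK (Z ω) (R ω))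
    (fun t ω => eventBound_nonneg hK t (Z ω) (R ω)) (integrable_eventBound hR hN K)

variable [MeasurableSpace J] [DiscreteMeasurableSpace J]

theorem integrable_exposure_zero (hρ : IsScalingFactor ρ) (hZ : Measurable Z) (hR : Measurable R)
    (j : J) : Integrable (fun ω => (Z ω).exposure ρ J₁ j 0 (R ω)) P := by
  obtain ⟨K, hK, -⟩ := hρ.exists_bound 0
  have hm := (measurable_exposure hρ.measurable J₁ j 0).comp (hZ.prodMk hR)
  refine Integrable.of_bound hm.aestronglyMeasurable K (Eventually.of_forall fun ω => ?_)
  simp only [exposure]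
  split_ifs
  · rw [Real.norm_eq_abs, abs_of_nonneg (scaling_nonneg hρ.nonneg _ _ _)]
    exact hK.scaling_le J₁ _ le_rfl
  · simpa using zero_le_one.trans hK.one_le

theorem target_exposure_controlledOn (hρ : IsScalingFactor ρ) (hZ : Measurable Z)
    (hR : Measurable R)
    (hN : ∀ j k : J, j ≠ k → ∀ t : ℝ≥0, Integrable (fun ω => ((Z ω).count j k t : ℝ)) P)
    {T : ℝ≥0} {K : ℝ} (hK : ScalingBound ρ T K) (j : J) :
    ControlledOn T (fun t => ∫ ω, eventBound K t (Z ω) (R ω) ∂P)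
      (fun t => ∫ ω, (Z ω).exposure ρ J₁ j t (R ω) ∂P) :=
  have hc := fun ω => exposure_controlledOn hK J₁ j (Z ω) (R ω)
  have hint := integrable_eventBound hR hN K
  controlledOn_integral hint (fun _ ht => integrable_of_controlledOn hint
    (fun t => (measurable_exposure hρ.measurable J₁ j t).comp (hZ.prodMk hR)) hc
    (integrable_exposure_zero hρ hZ hR j) ht) hc

theorem integrable_transitions (hρ : IsScalingFactor ρ) (hZ : Measurable Z)
    (hR : Measurable R)
    (hN : ∀ j k : J, j ≠ k → ∀ t : ℝ≥0, Integrable (fun ω => ((Z ω).count j k t : ℝ)) P)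
    {j k : J} (hjk : j ≠ k) (t : ℝ≥0) :
    Integrable (fun ω => (Z ω).transitions ρ J₁ j k t (R ω)) P := by
  obtain ⟨K, hK, -⟩ := hρ.exists_bound t
  exact integrable_of_controlledOn (integrable_eventBound hR hN K)
    (fun t' => (measurable_transitions hρ.measurable J₁ hjk t').comp (hZ.prodMk hR))
    (fun ω => transitions_controlledOn hK J₁ hjk (Z ω) (R ω)) (integrable_transitions_zero j k)
    le_rfl

theorem target_transitions_controlledOn (hρ : IsScalingFactor ρ) (hZ : Measurable Z)
    (hR : Measurable R)
    (hN : ∀ j k : J, j ≠ k → ∀ t : ℝ≥0, Integrable (fun ω => ((Z ω).count j k t : ℝ)) P)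
    {T : ℝ≥0} {K : ℝ} (hK : ScalingBound ρ T K) {j k : J} (hjk : j ≠ k) :
    ControlledOn T (fun t => ∫ ω, eventBound K t (Z ω) (R ω) ∂P)
      (fun t => ∫ ω, (Z ω).transitions ρ J₁ j k t (R ω) ∂P) :=
  controlledOn_integral (integrable_eventBound hR hN K)
    (fun _ _ => integrable_transitions hρ hZ hR hN hjk _)
    fun ω => transitions_controlledOn hK J₁ hjk (Z ω) (R ω)

theorem locallyControlled_target_exposure (hρ : IsScalingFactor ρ) (hZ : Measurable Z)
    (hR : Measurable R)
    (hN : ∀ j k : J, j ≠ k → ∀ t : ℝ≥0, Integrable (fun ω => ((Z ω).count j k t : ℝ)) P) (j : J) :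
    LocallyControlled fun t => ∫ ω, (Z ω).exposure ρ J₁ j t (R ω) ∂P := fun T =>
  let ⟨_, hK, _⟩ := hρ.exists_bound T
  ⟨_, isControl_integral_eventBound hR hN (zero_le_one.trans hK.one_le),
    target_exposure_controlledOn hρ hZ hR hN hK j⟩

theorem isControl_target_transitions (hρ : IsScalingFactor ρ) (hZ : Measurable Z)
    (hR : Measurable R)
    (hN : ∀ j k : J, j ≠ k → ∀ t : ℝ≥0, Integrable (fun ω => ((Z ω).count j k t : ℝ)) P)
    {j k : J} (hjk : j ≠ k) :
    IsControl fun t => ∫ ω, (Z ω).transitions ρ J₁ j k t (R ω) ∂P :=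
  LocallyControlled.isControl (fun T =>
    let ⟨_, hK, _⟩ := hρ.exists_bound T
    ⟨_, isControl_integral_eventBound hR hN (zero_le_one.trans hK.one_le),
      target_transitions_controlledOn hρ hZ hR hN hK hjk⟩)
    fun s t hst => integral_mono (integrable_transitions hρ hZ hR hN hjk s)
      (integrable_transitions hρ hZ hR hN hjk t)
      fun ω => transitions_mono hρ.nonneg J₁ hjk (Z ω) (R ω) hst

theorem targetHazardEntry_controlledOn (hρ : IsScalingFactor ρ) (hZ : Measurable Z)
    (hR : Measurable R)
    (hN : ∀ j k : J, j ≠ k → ∀ t : ℝ≥0, Integrable (fun ω => ((Z ω).count j k t : ℝ)) P)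
    {ε : ℝ} (hε : 0 < ε) {T : ℝ≥0} {K : ℝ} (hK : ScalingBound ρ T K) {j k : J} (hjk : j ≠ k) :
    ControlledOn T (fun t => 1 / ε * ∫ ω, eventBound K t (Z ω) (R ω) ∂P)
      (targetHazardEntry P Z R J₁ ε ρ j k) :=
  perturbedHazard_controlledOn hε
    (locallyControlled_target_exposure hρ hZ hR hN j).exists_tendsto_left
    (isControl_target_transitions hρ hZ hR hN hjk)
    (target_transitions_controlledOn hρ hZ hR hN hK hjk)

theorem tendstoUniformlyOn_nelsonAalenEntry (hρ : IsScalingFactor ρ) (hZ : Measurable Z)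
    (hR : Measurable R)
    (hN : ∀ j k : J, j ≠ k → ∀ t : ℝ≥0, Integrable (fun ω => ((Z ω).count j k t : ℝ)) P)
    {Zs : ℕ → Ω → JumpPath J} {Rs : ℕ → Ω → ℝ≥0}
    (h_indep : iIndepFun (fun l ω => (Zs l ω, Rs l ω)) P)
    (h_ident : ∀ l, IdentDistrib (fun ω => (Zs l ω, Rs l ω)) (fun ω => (Z ω, R ω)) P P)
    {ε : ℝ} (hε : 0 < ε) (T : ℝ≥0) {j k : J} (hjk : j ≠ k) :
    ∀ᵐ ω ∂P, TendstoUniformlyOn (fun n => nelsonAalenEntry Zs Rs J₁ ε ρ n ω j k)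
      (targetHazardEntry P Z R J₁ ε ρ j k) atTop (Set.Icc 0 T) := by
  obtain ⟨K, hK, -⟩ := hρ.exists_bound T
  have hK0 : 0 ≤ K := zero_le_one.trans hK.one_le
  have h1 := tendstoUniformlyOn_avg h_indep h_ident (hZ.prodMk hR)
    (V := fun t p => eventBound K t p.1 p.2) (Y := fun t p => p.1.exposure ρ J₁ j t p.2)
    (fun t => measurable_eventBound K t) (fun t => measurable_exposure hρ.measurable J₁ j t)
    (fun p => isControl_eventBound hK0 p.1 p.2) (fun t p => eventBound_nonneg hK0 t p.1 p.2)
    (integrable_eventBound hR hN K) (fun p => exposure_controlledOn hK J₁ j p.1 p.2)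
    (integrable_exposure_zero hρ hZ hR j)
  have h2 := tendstoUniformlyOn_avg h_indep h_ident (hZ.prodMk hR)
    (V := fun t p => eventBound K t p.1 p.2) (Y := fun t p => p.1.transitions ρ J₁ j k t p.2)
    (fun t => measurable_eventBound K t) (fun t => measurable_transitions hρ.measurable J₁ hjk t)
    (fun p => isControl_eventBound hK0 p.1 p.2) (fun t p => eventBound_nonneg hK0 t p.1 p.2)
    (integrable_eventBound hR hN K) (fun p => transitions_controlledOn hK J₁ hjk p.1 p.2)
    (integrable_transitions_zero j k)
  filter_upwards [h1, h2] with ω h1 h2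
  exact tendstoUniformlyOn_perturbedHazard hε
    (fun n => (locallyControlled_avg_exposure hρ n ω j).exists_tendsto_left)
    (locallyControlled_target_exposure hρ hZ hR hN j).exists_tendsto_left
    (fun n => isControl_avg_transitions hρ n ω hjk)
    (isControl_target_transitions hρ hZ hR hN hjk)
    (isControl_integral_eventBound hR hN hK0)
    (target_exposure_controlledOn hρ hZ hR hN hK j) h1 h2

end Targets

section Consistency

open scoped Matrix.Norms.Operator

variable {J : Type*} [TopologicalSpace J] [DiscreteTopology J] [Fintype J] [DecidableEq J]
  [MeasurableSpace J] {Ω : Type*} {Zs : ℕ → Ω → JumpPath J} {Rs : ℕ → Ω → ℝ≥0} {J₁ : Set J}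
  {ε : ℝ} {ρ : ℝ≥0 → J → J → JumpPath J → ℝ}

theorem nelsonAalen_controlledOn (hρ : IsScalingFactor ρ) (hε : 0 < ε) {T : ℝ≥0} {K : ℝ}
    (hK : ScalingBound ρ T K) (hKu : ScalingBound (unscaled (J := J)) T K) (n : ℕ) (ω : Ω) :
    ControlledOn T
      (hazardControl J ε fun t => avg n fun l => eventBound K t (Zs l ω) (Rs l ω))
      (nelsonAalen Zs Rs J₁ ε ρ n ω) :=
  hazardMatrix_controlledOn J₁ ((isControl_avg n fun l => isControl_eventBound
      (zero_le_one.trans hK.one_le) (Zs l ω) (Rs l ω)).const_mul (by positivity)).mono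
    (fun _ _ hjk => nelsonAalenEntry_controlledOn hρ hε hK n ω hjk)
    (fun _ _ hjk => nelsonAalenEntry_controlledOn isScalingFactor_unscaled hε hKu n ω hjk)

theorem exists_isProdInt_nelsonAalen [Nonempty J] (hρ : IsScalingFactor ρ) (hε : 0 < ε) (n : ℕ)
    (ω : Ω) (t : ℝ≥0) : ∃ M, IsProdInt (nelsonAalen Zs Rs J₁ ε ρ n ω) t M := by
  obtain ⟨K, hK, hKu⟩ := hρ.exists_bound t
  exact exists_isProdInt (isControl_hazardControl hε (isControl_avg n fun l =>
    isControl_eventBound (zero_le_one.trans hK.one_le) (Zs l ω) (Rs l ω)))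
    (nelsonAalen_controlledOn hρ hε hK hKu n ω) le_rfl

variable [DiscreteMeasurableSpace J] [MeasurableSpace Ω] {P : Measure Ω} [IsProbabilityMeasure P]
  {Z : Ω → JumpPath J} {R : Ω → ℝ≥0}

theorem targetHazard_controlledOn (hρ : IsScalingFactor ρ) (hZ : Measurable Z) (hR : Measurable R)
    (hN : ∀ j k : J, j ≠ k → ∀ t : ℝ≥0, Integrable (fun ω => ((Z ω).count j k t : ℝ)) P)
    (hε : 0 < ε) {T : ℝ≥0} {K : ℝ} (hK : ScalingBound ρ T K)
    (hKu : ScalingBound (unscaled (J := J)) T K) :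
    ControlledOn T (hazardControl J ε fun t => ∫ ω, eventBound K t (Z ω) (R ω) ∂P)
      (targetHazard P Z R J₁ ε ρ) :=
  hazardMatrix_controlledOn J₁ ((isControl_integral_eventBound hR hN
      (zero_le_one.trans hK.one_le)).const_mul (by positivity)).mono
    (fun _ _ hjk => targetHazardEntry_controlledOn hρ hZ hR hN hε hK hjk)
    (fun _ _ hjk => targetHazardEntry_controlledOn isScalingFactor_unscaled hZ hR hN hε hKu hjk)

theorem exists_isProdInt_targetHazard [Nonempty J] (hρ : IsScalingFactor ρ) (hZ : Measurable Z)
    (hR : Measurable R)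
    (hN : ∀ j k : J, j ≠ k → ∀ t : ℝ≥0, Integrable (fun ω => ((Z ω).count j k t : ℝ)) P)
    (hε : 0 < ε) (t : ℝ≥0) : ∃ M, IsProdInt (targetHazard P Z R J₁ ε ρ) t M := by
  obtain ⟨K, hK, hKu⟩ := hρ.exists_bound t
  exact exists_isProdInt (isControl_hazardControl hε (isControl_integral_eventBound hR hN
    (zero_le_one.trans hK.one_le))) (targetHazard_controlledOn hρ hZ hR hN hε hK hKu) le_rfl

theorem tendstoUniformlyOn_nelsonAalen (hρ : IsScalingFactor ρ) (hZ : Measurable Z)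
    (hR : Measurable R)
    (hN : ∀ j k : J, j ≠ k → ∀ t : ℝ≥0, Integrable (fun ω => ((Z ω).count j k t : ℝ)) P)
    (h_indep : iIndepFun (fun l ω => (Zs l ω, Rs l ω)) P)
    (h_ident : ∀ l, IdentDistrib (fun ω => (Zs l ω, Rs l ω)) (fun ω => (Z ω, R ω)) P P)
    (hε : 0 < ε) (T : ℝ≥0) :
    ∀ᵐ ω ∂P, ∀ j k : J, TendstoUniformlyOn
      (fun n t => nelsonAalen Zs Rs J₁ ε ρ n ω t j k)
      (fun t => targetHazard P Z R J₁ ε ρ t j k) atTop (Set.Icc 0 T) := by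
  have h : ∀ {σ : ℝ≥0 → J → J → JumpPath J → ℝ}, IsScalingFactor σ →
      ∀ᵐ ω ∂P, ∀ j k : J, j ≠ k → TendstoUniformlyOn
        (fun n => nelsonAalenEntry Zs Rs J₁ ε σ n ω j k)
        (targetHazardEntry P Z R J₁ ε σ j k) atTop (Set.Icc 0 T) := fun hσ =>
    ae_all_iff.2 fun j => ae_all_iff.2 fun k => ae_all_iff.2 fun hjk =>
      tendstoUniformlyOn_nelsonAalenEntry hσ hZ hR hN h_indep h_ident hε T hjk
  filter_upwards [h hρ, h isScalingFactor_unscaled] with ω h1 h2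
  exact tendstoUniformlyOn_hazardMatrix J₁ h1 h2

theorem tendstoUniformlyOn_aalenJohansen [Nonempty J] (hρ : IsScalingFactor ρ) (hZ : Measurable Z)
    (hR : Measurable R)
    (hN : ∀ j k : J, j ≠ k → ∀ t : ℝ≥0, Integrable (fun ω => ((Z ω).count j k t : ℝ)) P)
    (h_indep : iIndepFun (fun l ω => (Zs l ω, Rs l ω)) P)
    (h_ident : ∀ l, IdentDistrib (fun ω => (Zs l ω, Rs l ω)) (fun ω => (Z ω, R ω)) P P)
    (hε : 0 < ε) (T : ℝ≥0) :
    ∀ᵐ ω ∂P, ∀ j k : J, TendstoUniformlyOn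
      (fun n t => prodInt (nelsonAalen Zs Rs J₁ ε ρ n ω) t j k)
      (fun t => prodInt (targetHazard P Z R J₁ ε ρ) t j k) atTop (Set.Icc 0 T) := by
  obtain ⟨K, hK, hKu⟩ := hρ.exists_bound T
  have hK0 : 0 ≤ K := zero_le_one.trans hK.one_le
  have hV : ∀ t, ∀ᵐ ω ∂P, Tendsto
      (fun n => hazardControl J ε (fun t => avg n fun l => eventBound K t (Zs l ω) (Rs l ω)) t)
      atTop (𝓝 (hazardControl J ε (fun t => ∫ ω, eventBound K t (Z ω) (R ω) ∂P) t)) := fun t => by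
    filter_upwards [avg_tendsto_integral h_indep h_ident (measurable_eventBound K t)
      (integrable_eventBound hR hN K t)] with ω h
    exact ((h.const_mul _).const_mul _).const_mul _
  filter_upwards [tendstoUniformlyOn_nelsonAalen hρ hZ hR hN h_indep h_ident hε T, hV T, hV 0]
    with ω h1 h2 h3
  exact tendstoUniformlyOn_prodInt
    (fun n => isControl_hazardControl hε
      (isControl_avg n fun l => isControl_eventBound hK0 (Zs l ω) (Rs l ω)))
    (isControl_hazardControl hε (isControl_integral_eventBound hR hN hK0))
    (fun n => nelsonAalen_controlledOn hρ hε hK hKu n ω)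
    (targetHazard_controlledOn hρ hZ hR hN hε hK hKu) h2 h3 h1

end Consistency

end ScaledAJ

theorem mainTheorem2
    {J : Type*} [Fintype J] [DecidableEq J] [TopologicalSpace J] [DiscreteTopology J]
    [MeasurableSpace J] [DiscreteMeasurableSpace J]
    {Ω : Type*} [MeasurableSpace Ω] (P : Measure Ω) [IsProbabilityMeasure P]
    -- the jump process and the right-censoring time
    (Z : Ω → ScaledAJ.JumpPath J) (hZ : Measurable Z)
    (R : Ω → ℝ≥0) (hR : Measurable R) (hR_pos : ∀ᵐ ω ∂P, 0 < R ω)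
    (z₀ : J) (hz₀ : ∀ᵐ ω ∂P, Z ω 0 = z₀)
    -- the states after exercise of the option; `J₁ᶜ` are the states before exercise
    (J₁ : Set J) (hz₀J : z₀ ∉ J₁)
    (hJ₁ : ∀ t s : ℝ≥0, t ≤ s → P {ω | Z ω t ∈ J₁ ∧ Z ω s ∉ J₁} = 0)
    (hN : ∀ j k : J, j ≠ k → ∀ t : ℝ≥0, Integrable (fun ω => ((Z ω).count j k t : ℝ)) P)
    -- the scaling factors
    (ρ : ℝ≥0 → J → J → ScaledAJ.JumpPath J → ℝ)
    (hρ_pred : ∀ j k : J, IsStronglyPredictable (ScaledAJ.JumpPath.canonicalFiltration J)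
      (fun t z => ρ t j k z))
    (hρ_nonneg : ∀ t j k z, 0 ≤ ρ t j k z)
    (hρ_bdd : ∀ T : ℝ≥0, ∃ C : ℝ, ∀ t ≤ T, ∀ j k z, ρ t j k z ≤ C)
    -- entirely random right-censoring
    (hZR : IndepFun Z R P)
    -- i.i.d. replicates
    (Zs : ℕ → Ω → ScaledAJ.JumpPath J) (Rs : ℕ → Ω → ℝ≥0)
    (h_indep : iIndepFun (fun l ω => (Zs l ω, Rs l ω)) P)
    (h_ident : ∀ l, IdentDistrib (fun ω => (Zs l ω, Rs l ω)) (fun ω => (Z ω, R ω)) P P)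
    (θ : ℝ≥0) (hθ : (θ : ℝ≥0∞) < ScaledAJ.rightEndpoint (P.map R))
    (ε : ℝ) (hε : 0 < ε) :
    -- the product integrals in the second claim exist
    (∀ t ≤ θ, ∃ M, ScaledAJ.IsProdInt (ScaledAJ.targetHazard P Z R J₁ ε ρ) t M) ∧
    (∀ n ω, ∀ t ≤ θ, ∃ M, ScaledAJ.IsProdInt (ScaledAJ.nelsonAalen Zs Rs J₁ ε ρ n ω) t M) ∧
    -- uniform strong consistency of the Nelson–Aalen estimator
    (∀ᵐ ω ∂P, ∀ j k : J, TendstoUniformlyOn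
      (fun (n : ℕ) t => ScaledAJ.nelsonAalen Zs Rs J₁ ε ρ n ω t j k)
      (fun t => ScaledAJ.targetHazard P Z R J₁ ε ρ t j k) atTop (Set.Icc 0 θ)) ∧
    -- uniform strong consistency of the Aalen–Johansen estimator
    (∀ᵐ ω ∂P, ∀ j : J, TendstoUniformlyOn
      (fun (n : ℕ) t => ScaledAJ.prodInt (ScaledAJ.nelsonAalen Zs Rs J₁ ε ρ n ω) t z₀ j)
      (fun t => ScaledAJ.prodInt (ScaledAJ.targetHazard P Z R J₁ ε ρ) t z₀ j)
      atTop (Set.Icc 0 θ)) := by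
  have : Nonempty J := ⟨z₀⟩
  have hρ : ScaledAJ.IsScalingFactor ρ :=
    ⟨fun j k => (hρ_pred j k).measurable.mono (ScaledAJ.predictable_le_prod _) le_rfl,
      hρ_nonneg, hρ_bdd⟩
  refine ⟨fun t _ => ScaledAJ.exists_isProdInt_targetHazard hρ hZ hR hN hε t,
    fun n ω t _ => ScaledAJ.exists_isProdInt_nelsonAalen hρ hε n ω t,
    ScaledAJ.tendstoUniformlyOn_nelsonAalen hρ hZ hR hN h_indep h_ident hε θ, ?_⟩
  filter_upwards [ScaledAJ.tendstoUniformlyOn_aalenJohansen hρ hZ hR hN h_indep h_ident hε θ]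
    with ω h
  exact h z₀
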